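/- **Notation.** $\hat f(\xi)=\int f(x)e^{-2\pi i\langle x,\xi\rangle}dx$ (extended to $L^2$). For $j\in\mathbb N_0$, $s\in\mathbb R$, $p\in\mathbb N_0$ let $$A_j=\begin{pmatrix}2^j&0\\0&2^{\lfloor j/2\rfloor}\end{pmatrix},\quad S_s=\begin{pmatrix}1&s\\0&1\end{pmatrix},\quad D_p=\mathrm{diag}(1,2^{-\max\{p-1,0\}}),$$ and $R_{\pi/2}(x_1,x_2)=(-x_2,x_1)$. A family $(e_i)_{i\in I}$ in a Hilbert space $H$ is a *frame* if there are $0<A\le B<\infty$ with $A\|f\|^2\le\sum_i|\langle f,e_i\rangle|^2\le B\|f\|^2$ for all $f\in H$; a frame $(\tilde e_i)_{i\in I}$ is a *dual frame* of $(e_i)_{i\in I}$ if $f=\sum_i\langle f,e_i\rangle\tilde e_i$ (unconditionally) for all $f\in H$. **Generators.** Let $\varphi_1,\psi_1\in L^2(\mathbb R)$ and $g\in L^2(\mathbb R^2)$ be compactly supported (complex-valued) functions such that * $\inf_{|\xi|\le 1/2}|\hat\varphi_1(\xi)|>0$, and $\inf_{\xi\in\Omega}|\hat g(\xi)|>0$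 for $\Omega=\{\xi:|\xi_2/\xi_1|<1,\ \tfrac12<|\xi_1|<1\}$; * for some $\rho\in(0,\tfrac2{13})$, $\alpha\ge\tfrac6\rho+1$, $\beta>\alpha+1$ and some constant $C$, for $\ell=0,1$ and all $\xi$, $$|\hat\psi_1^{(\ell)}(\xi)|\le C\frac{\min\{1,|\xi|^\alpha\}}{(1+|\xi|)^\beta},\quad |\hat\varphi_1^{(\ell)}(\xi)|\le\frac{C}{(1+|\xi|)^\beta},\quad |\partial_{\xi_2}^\ell\hat g(\xi)|\le C\frac{\min\{1,|\xi_1|^\alpha\}}{(1+|\xi_1|)^\beta(1+|\xi_2|)^\beta};$$ * $\{\varphi_1(\cdot-m):m\in\mathbb Z\}\cup\{2^{j/2}\psi_1(2^j\cdot-m):j\ge0,\,m\in\mathbb Z\}$ is an orthonormal basis of $L^2(\mathbb R)$. **The system.** Put $\varphi^0(x)=\varphi_1(x_1)\varphi_1(x_2)$, $\psi^0(x)=\psi_1(x_1)\varphi_1(x_2)$ and, for $p>0$, $\varphi^p(x)=2^{(p-1)/2}\varphi_1(x_1)\psi_1(2^{p-1}x_2)$, $\psi^p(x)=2^{(p-1)/2}\psi_1(x_1)\psi_1(2^{p-1}x_2)$.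 Let $\mathbb S=\{0\}\cup\{q2^{-j}:j\ge0,\ q\text{ odd},\ |q|\le2^j\}$ and, for $s\in\mathbb S$, let $j_0=j_0(s)$ be the smallest nonnegative integer with $s\,2^{\lceil j_0/2\rceil}\in\mathbb Z$. Let $\Lambda_s$ be the set of $\lambda=(j,s,m,p)$ with $j\in\{-1\}\cup\{j_0,j_0+1,\dots\}$, $m\in\mathbb Z^2$, $p\in\mathbb N_0$, and set $$w_\lambda=|\det A_{j_0}|^{1/2}\varphi^p(A_{j_0}S_s\cdot-D_pm)\ \ (j=-1),\qquad w_\lambda=|\det A_j|^{1/2}\psi^p(A_jS_s\cdot-D_pm)\ \ (j\ge j_0).$$ The filters $G_s$, $s\in\mathbb S$, are given by $$\hat G_s(\xi)=\mathbf 1_{\{s=0\}}|\hat\varphi^0(\xi)|^2+\sum_{j\ge j_0(s)}|\hat g(A_j^{-1}S_s^{-T}\xi)|^2 .$$ The dualizable shearlet system $\mathcal{SH}(\varphi_1,\psi_1;g)=\{\psi^\ell_\lambda:\lambda\in\Lambda_s,\ s\in\mathbb S,\ \ell=0,1\}$ consists of $\psi^0_\lambda=G_s*w_\lambda$ (that is,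 $\hat\psi^0_\lambda=\hat G_s\hat w_\lambda$) and $\psi^1_\lambda=\psi^0_\lambda\circ R_{\pi/2}$. **Theorem.** The series defining $\hat G_s$ and $\mathcal D:=\sum_{s'\in\mathbb S}\bigl(|\hat G_{s'}|^2+|\hat G_{s'}\circ R_{\pi/2}|^2\bigr)$ converge a.e., $\mathcal D$ lies a.e. between two positive constants, all $w_\lambda,\psi^\ell_\lambda$ are in $L^2(\mathbb R^2)$, and $\mathcal{SH}(\varphi_1,\psi_1;g)$ is a frame for $L^2(\mathbb R^2)$. The functions $\tilde\psi^\ell_\lambda\in L^2(\mathbb R^2)$ given by $$\hat{\tilde\psi}{}^0_\lambda=\frac{\hat G_s\,\hat w_\lambda}{\sum_{s'\in\mathbb S}|\hat G_{s'}|^2+|\hat G_{s'}\circ R_{\pi/2}|^2}=\frac{\hat\psi^0_\lambda}{\mathcal D},\qquad \tilde\psi^1_\lambda=\tilde\psi^0_\lambda\circ R_{\pi/2}\qquad(\lambda\in\Lambda_s)$$ also form a frame for $L^2(\mathbb R^2)$. If moreover $\varphi_1$ and $g$ are real-valued, then $\{\tilde\psi^\ell_\lambda\}$ is a dual frame of $\{\psi^\ell_\lambda\}$.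 -/

import Mathlib

open MeasureTheory FourierTransform
open scoped ENNReal

noncomputable section

namespace DualizableShearlet

/-- The plane `ℝ²` with its Euclidean structure. -/
abbrev Plane : Type := EuclideanSpace ℝ (Fin 2)

/-- The Hilbert space `L²(ℝ²)` of (classes of) complex-valued functions. -/
abbrev L2Plane : Type := Lp ℂ 2 (volume : Measure Plane)

/-! ### Frames -/

/-- `(e i)` is a frame of `H`: there are `0 < A ≤ B < ∞` with
`A ‖f‖² ≤ ∑ |⟨f, e i⟩|² ≤ B ‖f‖²` for all `f`. -/
def IsFrame {H : Type*} [NormedAddCommGroup H] [InnerProductSpace ℂ H] {ι : Type*}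
    (e : ι → H) : Prop :=
  ∃ A B : ℝ, 0 < A ∧ A ≤ B ∧ ∀ f : H,
    Summable (fun i => ‖inner ℂ (e i) f‖ ^ 2) ∧
    A * ‖f‖ ^ 2 ≤ ∑' i, ‖inner ℂ (e i) f‖ ^ 2 ∧
    ∑' i, ‖inner ℂ (e i) f‖ ^ 2 ≤ B * ‖f‖ ^ 2

/-- Reconstruction formula `f = ∑ ⟨f, e i⟩ e' i` for all `f`, with unconditional convergence.
Mathlib's inner product is linear in its second argument. -/
def Reconstructs {H : Type*} [NormedAddCommGroup H] [InnerProductSpace ℂ H] {ι : Type*}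
    (e e' : ι → H) : Prop :=
  ∀ f : H, HasSum (fun i => inner ℂ (e i) f • e' i) f

/-- `(e' i)` is a dual frame associated with the frame `(e i)`. -/
def IsDualFrame {H : Type*} [NormedAddCommGroup H] [InnerProductSpace ℂ H] {ι : Type*}
    (e e' : ι → H) : Prop :=
  IsFrame e ∧ IsFrame e' ∧ Reconstructs e e'

/-! ### Matrices -/

/-- Parabolic scaling `A_j = diag(2^j, 2^⌊j/2⌋)` (division of natural numbers rounds down). -/
def scaleMat (j : ℕ) : Matrix (Fin 2) (Fin 2) ℝ := !![2 ^ j, 0; 0, 2 ^ (j / 2)]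

/-- Shear matrix `S_s`. -/
def shearMat (s : ℝ) : Matrix (Fin 2) (Fin 2) ℝ := !![1, s; 0, 1]

/-- `D_p = diag(1, 2^{-max(p-1,0)})` (subtraction of natural numbers is truncated). -/
def overMat (p : ℕ) : Matrix (Fin 2) (Fin 2) ℝ := !![1, 0; 0, ((2 : ℝ) ^ (p - 1))⁻¹]

/-- The vector `M x` for a `2 × 2` matrix `M`. -/
def act (M : Matrix (Fin 2) (Fin 2) ℝ) (x : Plane) : Plane := Matrix.toEuclideanLin M x

/-- A point of `ℤ²` seen in the plane. -/
def latticePt (m : ℤ × ℤ) : Plane := !₂[(m.1 : ℝ), (m.2 : ℝ)]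

/-- The rotation `R_{π/2} : (x₁, x₂) ↦ (-x₂, x₁)`. -/
def rot : Plane ≃ₗᵢ[ℝ] Plane where
  toFun x := !₂[-x 1, x 0]
  invFun x := !₂[x 1, -x 0]
  left_inv x := by ext i; fin_cases i <;> simp
  right_inv x := by ext i; fin_cases i <;> simp
  map_add' x y := by ext i; fin_cases i <;> simp [add_comm]
  map_smul' c x := by ext i; fin_cases i <;> simp
  norm_map' x := by simp [EuclideanSpace.norm_eq, Fin.sum_univ_two, add_comm]

/-! ### Shear parameters and index sets -/

/-- The set of shear parameters: `0` and all `q / 2^j` with `j ≥ 0`, `q` odd, `|q| ≤ 2^j`. -/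
def shearSet : Set ℝ :=
  {s | s = 0 ∨ ∃ (j : ℕ) (q : ℤ), Odd q ∧ |q| ≤ 2 ^ j ∧ s = (q : ℝ) / 2 ^ j}

/-- The smallest `j₀ ≥ 0` such that `s = q₀ / 2^⌈j₀/2⌉` for some integer `q₀`;
`(j + 1) / 2` is `⌈j/2⌉`. -/
def startScale (s : ℝ) : ℕ := sInf {j : ℕ | ∃ q : ℤ, s = (q : ℝ) / 2 ^ ((j + 1) / 2)}

/-- The scale index of an element of `Λ_s`: `none` stands for `-1`, `some j` for `j ≥ j₀`. -/
abbrev ScaleIdx (s : ℝ) : Type := Option {j : ℕ // startScale s ≤ j}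

/-- The index set `Λ_s` of triples `(j, m, p)`, the parameter `s` being fixed. -/
abbrev Lam (s : ℝ) : Type := ScaleIdx s × (ℤ × ℤ) × ℕ

/-- The index set `{0,1} × ⋃_s Λ_s` of the full system. -/
abbrev Idx : Type := Fin 2 × (Σ s : shearSet, Lam (s : ℝ))

/-! ### Generators -/

/-- The cone piece `{ |ξ₂/ξ₁| < 1, 1/2 < |ξ₁| < 1 }`. -/
def coneSet : Set Plane := {ξ | |ξ 1 / ξ 0| < 1 ∧ 1 / 2 < |ξ 0| ∧ |ξ 0| < 1}

/-- The family `φ₁(· - m)` (`m ∈ ℤ`), `2^{j/2} ψ₁(2^j · - m)` (`j ≥ 0`, `m ∈ ℤ`). -/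
def waveletFun (φ₁ ψ₁ : ℝ → ℂ) : ℤ ⊕ (ℕ × ℤ) → ℝ → ℂ
  | Sum.inl m => fun x => φ₁ (x - m)
  | Sum.inr (j, m) => fun x => (((2 : ℝ) ^ ((j : ℝ) / 2) : ℝ) : ℂ) * ψ₁ (2 ^ j * x - m)

/-- The family of functions is an orthonormal basis of `L²(ℝ)`. -/
def IsONBFun {ι : Type*} (e : ι → ℝ → ℂ) : Prop :=
  ∃ b : HilbertBasis ι ℂ (Lp ℂ 2 (volume : Measure ℝ)), ∀ i, b i =ᵐ[volume] e i

/-- The conditions imposed on the generators `φ₁, ψ₁, g` of a dualizable shearlet system. -/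
structure IsGenerator (φ₁ ψ₁ : ℝ → ℂ) (g : Plane → ℂ) : Prop where
  memLp_phi : MemLp φ₁ 2 volume
  memLp_psi : MemLp ψ₁ 2 volume
  memLp_g : MemLp g 2 volume
  compact_phi : HasCompactSupport φ₁
  compact_psi : HasCompactSupport ψ₁
  compact_g : HasCompactSupport g
  /-- `inf |φ̂₁| > 0` on `[-1/2, 1/2]` -/
  support_phi : ∃ δ : ℝ, 0 < δ ∧ ∀ ξ ∈ Set.Icc (-(1 / 2) : ℝ) (1 / 2), δ ≤ ‖𝓕 φ₁ ξ‖
  /-- `inf |ĝ| > 0` on the cone piece -/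
  support_g : ∃ δ : ℝ, 0 < δ ∧ ∀ ξ ∈ coneSet, δ ≤ ‖𝓕 g ξ‖
  onb : IsONBFun (waveletFun φ₁ ψ₁)
  /-- decay conditions, with common parameters `ρ, α, β` -/
  decay : ∃ ρ α β : ℝ, 0 < ρ ∧ ρ < 2 / 13 ∧ 6 / ρ + 1 ≤ α ∧ α + 1 < β ∧ ∃ C : ℝ,
    ∀ l : ℕ, l ≤ 1 →
      (∀ ξ : ℝ, ‖iteratedDeriv l (𝓕 ψ₁) ξ‖ ≤ C * (min 1 (|ξ| ^ α) / (1 + |ξ|) ^ β)) ∧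
      (∀ ξ : ℝ, ‖iteratedDeriv l (𝓕 φ₁) ξ‖ ≤ C * (1 / (1 + |ξ|) ^ β)) ∧
      (∀ ξ : Plane, ‖iteratedDeriv l (fun t : ℝ => 𝓕 g !₂[ξ 0, t]) (ξ 1)‖ ≤
        C * (min 1 (|ξ 0| ^ α) / ((1 + |ξ 0|) ^ β * (1 + |ξ 1|) ^ β)))

/-! ### Shearlet-type wavelet systems -/

/-- `h⁰(x) = h(x₁) φ₁(x₂)` and `h^p(x) = 2^{(p-1)/2} h(x₁) ψ₁(2^{p-1} x₂)` for `p > 0`;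
this is `φ^p` for `h = φ₁` and `ψ^p` for `h = ψ₁`. -/
def liftFun (φ₁ ψ₁ h : ℝ → ℂ) : ℕ → Plane → ℂ
  | 0 => fun x => h (x 0) * φ₁ (x 1)
  | p + 1 => fun x => (((2 : ℝ) ^ ((p : ℝ) / 2) : ℝ) : ℂ) * (h (x 0) * ψ₁ (2 ^ p * x 1))

/-- `|det A_j|^{1/2} F(A_j S_s · - D_p m)`. -/
def dilate (F : Plane → ℂ) (j : ℕ) (s : ℝ) (m : ℤ × ℤ) (p : ℕ) (x : Plane) : ℂ :=
  ((Real.sqrt |(scaleMat j).det| : ℝ) : ℂ) *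
    F (act (scaleMat j * shearMat s) x - act (overMat p) (latticePt m))

/-- The elements `φ_{j₀,s,m,p}` (scale index `-1`) and `ψ_{j,s,m,p}` (`j ≥ j₀`) of the
shearlet-type wavelet system with shear parameter `s`. -/
def waveletElt (φ₁ ψ₁ : ℝ → ℂ) (s : ℝ) : Lam s → Plane → ℂ
  | (none, m, p) => dilate (liftFun φ₁ ψ₁ φ₁ p) (startScale s) s m p
  | (some j, m, p) => dilate (liftFun φ₁ ψ₁ ψ₁ p) j s m p

/-! ### Filters -/

/-- The `j`-th term `|ĝ(A_j⁻¹ S_s⁻ᵀ ξ)|²` of the filter. -/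
def filterTerm (g : Plane → ℂ) (s : ℝ) (j : ℕ) (ξ : Plane) : ℝ :=
  ‖𝓕 g (act ((scaleMat j)⁻¹ * ((shearMat s).transpose)⁻¹) ξ)‖ ^ 2

open Classical in
/-- The Fourier transform `Ĝ_s` of the filter `G_s`: the sum of the terms with `j ≥ j₀`, and in
addition `|φ̂⁰|²` for `s = 0`. -/
def filterHat (φ₁ ψ₁ : ℝ → ℂ) (g : Plane → ℂ) (s : ℝ) (ξ : Plane) : ℝ :=
  (if s = 0 then ‖𝓕 (liftFun φ₁ ψ₁ φ₁ 0) ξ‖ ^ 2 else 0) +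
    ∑' j : {j : ℕ // startScale s ≤ j}, filterTerm g s j ξ

/-- The denominator `∑_s |Ĝ_s|² + |Ĝ_s ∘ R_{π/2}|²`. -/
def filterSum (φ₁ ψ₁ : ℝ → ℂ) (g : Plane → ℂ) (ξ : Plane) : ℝ :=
  ∑' s : shearSet, (filterHat φ₁ ψ₁ g s ξ ^ 2 + filterHat φ₁ ψ₁ g s (rot ξ) ^ 2)

/-! ### The dualizable shearlet system and its dual -/

open Classical in
/-- The class in `L²(ℝ²)` of a square-integrable function (and `0` for other functions). -/
def toL2 (F : Plane → ℂ) : L2Plane :=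
  if h : MemLp F 2 (volume : Measure Plane) then h.toLp F else 0

/-- The Fourier multiplier operator `f ↦ (m f̂)^∨` on `L²(ℝ²)`; for `m = Ĝ` this is
the convolution `f ↦ G * f`. -/
def fourierMul (m : Plane → ℝ) (f : L2Plane) : L2Plane :=
  𝓕⁻ (toL2 (fun ξ => (m ξ : ℂ) * (𝓕 f : L2Plane) ξ))

/-- `f ↦ f ∘ R_{π/2}` on `L²(ℝ²)`. -/
def rotL2 (f : L2Plane) : L2Plane :=
  Lp.compMeasurePreserving rot rot.measurePreserving f

/-- `ψ⁰_λ = G_s * φ_{j₀,s,m,p}`, respectively `G_s * ψ_{j,s,m,p}`. -/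
def shearlet0 (φ₁ ψ₁ : ℝ → ℂ) (g : Plane → ℂ) (s : ℝ) (l : Lam s) : L2Plane :=
  fourierMul (filterHat φ₁ ψ₁ g s) (toL2 (waveletElt φ₁ ψ₁ s l))

/-- The dual element, whose Fourier transform is that of `ψ⁰_λ` divided by `filterSum`,
that is, `Ĝ_s` times the Fourier transform of the element of the shearlet-type wavelet system,
divided by `filterSum`. -/
def dual0 (φ₁ ψ₁ : ℝ → ℂ) (g : Plane → ℂ) (s : ℝ) (l : Lam s) : L2Plane :=
  fourierMul (fun ξ => filterHat φ₁ ψ₁ g s ξ / filterSum φ₁ ψ₁ g ξ)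
    (toL2 (waveletElt φ₁ ψ₁ s l))

/-- The dualizable shearlet system `(ψ^ℓ_λ)`, with `ψ¹_λ = ψ⁰_λ ∘ R_{π/2}`. -/
def shearletSystem (φ₁ ψ₁ : ℝ → ℂ) (g : Plane → ℂ) (i : Idx) : L2Plane :=
  if i.1 = 0 then shearlet0 φ₁ ψ₁ g i.2.1 i.2.2 else rotL2 (shearlet0 φ₁ ψ₁ g i.2.1 i.2.2)

/-- The system of the dual elements, with `ψ̃¹_λ = ψ̃⁰_λ ∘ R_{π/2}`. -/
def dualSystem (φ₁ ψ₁ : ℝ → ℂ) (g : Plane → ℂ) (i : Idx) : L2Plane :=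
  if i.1 = 0 then dual0 φ₁ ψ₁ g i.2.1 i.2.2 else rotL2 (dual0 φ₁ ψ₁ g i.2.1 i.2.2)

/-- The series defining the filters and the denominator converge a.e., and the denominator lies
between two positive constants a.e. -/
def FiltersConverge (φ₁ ψ₁ : ℝ → ℂ) (g : Plane → ℂ) : Prop :=
  ∃ A B : ℝ, 0 < A ∧ A ≤ B ∧ ∀ᵐ ξ : Plane,
    (∀ s : shearSet,
      Summable (fun j : {j : ℕ // startScale (s : ℝ) ≤ j} => filterTerm g s j ξ)) ∧
    Summable (fun s : shearSet =>
      filterHat φ₁ ψ₁ g s ξ ^ 2 + filterHat φ₁ ψ₁ g s (rot ξ) ^ 2) ∧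
    A ≤ filterSum φ₁ ψ₁ g ξ ∧ filterSum φ₁ ψ₁ g ξ ≤ B

/-- The elements are genuine square-integrable functions with the asserted Fourier transforms:
`ψ⁰_λ` is the filtered wavelet element, and `ψ̃⁰_λ` has Fourier transform `ψ̂⁰_λ` divided by
the denominator. -/
def FourierFormulas (φ₁ ψ₁ : ℝ → ℂ) (g : Plane → ℂ) : Prop :=
  ∀ (s : shearSet) (l : Lam (s : ℝ)),
    MemLp (waveletElt φ₁ ψ₁ s l) 2 volume ∧
    ((𝓕 (shearlet0 φ₁ ψ₁ g s l) : L2Plane) =ᵐ[volume] fun ξ =>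
      (filterHat φ₁ ψ₁ g s ξ : ℂ) * (𝓕 (toL2 (waveletElt φ₁ ψ₁ s l)) : L2Plane) ξ) ∧
    ((𝓕 (dual0 φ₁ ψ₁ g s l) : L2Plane) =ᵐ[volume] fun ξ =>
      (𝓕 (shearlet0 φ₁ ψ₁ g s l) : L2Plane) ξ / (filterSum φ₁ ψ₁ g ξ : ℂ))

end DualizableShearlet

end

/-!
For a fixed shear parameter `s` the elements `w_λ`, `λ ∈ Λ_s`, satisfy Parseval's identity on
`L²(ℝ²)`. In the sheared coordinates `S_s x` each of them is a product: the first factors are the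
given wavelet basis dilated by `2^j₀`, and for every first factor of scale `j` the second factors
are the same basis dilated by `2^⌊j/2⌋`. The second basis changes with the scale, but Tonelli's
theorem only needs a Parseval family for each single first factor (`IsParseval.tensor`,
`isParseval_waveletElt`).

Filtering by a real multiplier `M_s` and rotating, Parseval's identity for each `s` and Plancherel's
theorem give
`∑ |⟨f, e_i⟩|² = ∫ ∑_s (M_s(ξ)² + M_s(Rξ)²) |f̂(ξ)|² dξ`
(`tsum_enorm_inner_filteredSystem`). With `M_s = Ĝ_s` the weight is the denominator `𝒟`; with
`M_s = Ĝ_s / 𝒟` it is comparable to `𝒟` with constants given by the bounds of `𝒟`. Both frame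
properties therefore follow from the two-sided bound on `𝒟`.

* Upper bound: by the decay of `ĝ`, the sum over all shears at scale `j` is at most a constant times
  `a / (1 + a)²` with `a = 2^{-j} |ξ₁|` (`tsum_shear_le`), and this weight telescopes along the
  dyadic scales (`tsum_dyadicWeight_le`). So `∑_s Ĝ_s` is bounded, and `∑_s Ĝ_s² ≤ (∑_s Ĝ_s)²`.
* Lower bound: for almost every `ξ`, either `ξ` lies in the square where `φ̂⁰` is bounded below, or
  a parabolic rescaling and a shear with slope in `[-1, 1]` map `ξ` or `Rξ` into the cone piece
  where `ĝ` is bounded below (`exists_shear_covering`).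

The identity above also says that the frame operator of the shearlet system is the Fourier
multiplier `𝒟` (`hasSum_frameOperator`). For real `φ₁` and `g` the filters are even, hence
`𝒟 ∘ R = 𝒟`, the multiplier `1 / 𝒟` commutes with the rotation, and the dual system is the image of
the shearlet system under the inverse of the frame operator (`dualSystem_eq_fourierMul`).
-/

open scoped ComplexConjugate

noncomputable section

namespace DualizableShearlet

/-! ### Parseval families of functions -/

section Parseval

variable {X Y ι κ : Type*} [MeasurableSpace X] [MeasurableSpace Y] {μ : Measure X} {ν : Measure Y}

lemma lintegral_enorm_sq_eq_eLpNorm (u : X → ℂ) :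
    ∫⁻ x, ‖u x‖ₑ ^ 2 ∂μ = eLpNorm u 2 μ ^ 2 := by
  rw [eLpNorm_eq_lintegral_rpow_enorm_toReal (by norm_num) (by norm_num)]
  rw [← ENNReal.rpow_natCast, ← ENNReal.rpow_mul]
  simp

lemma memLp_two_iff_lintegral {u : X → ℂ} (hu : AEStronglyMeasurable u μ) :
    MemLp u 2 μ ↔ ∫⁻ x, ‖u x‖ₑ ^ 2 ∂μ < ∞ := by
  rw [lintegral_enorm_sq_eq_eLpNorm]
  constructor
  · intro h
    exact ENNReal.pow_lt_top h.2
  · intro h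
    exact ⟨hu, by simpa using h⟩

lemma lintegral_enorm_sq_lp (f : Lp ℂ 2 μ) : ∫⁻ x, ‖f x‖ₑ ^ 2 ∂μ = ‖f‖ₑ ^ 2 := by
  rw [lintegral_enorm_sq_eq_eLpNorm, Lp.enorm_def]

lemma inner_toLp_eq {u : X → ℂ} {e : X → ℂ} {b f : Lp ℂ 2 μ} (hb : b =ᵐ[μ] e) (hf : f =ᵐ[μ] u) :
    inner ℂ b f = ∫ x, conj (e x) * u x ∂μ := by
  rw [L2.inner_def]
  refine integral_congr_ae ?_
  filter_upwards [hb, hf] with x h1 h2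
  rw [h1, h2, RCLike.inner_apply, mul_comm]

/-- The functions `e i` are square integrable and satisfy Parseval's identity
`∑ |∫ conj (e i) u|² = ∫ |u|²` for all square-integrable `u`. Both sides are extended nonnegative
reals, so that the order of sums and integrals is free. -/
def IsParseval (μ : Measure X) (e : ι → X → ℂ) : Prop :=
  (∀ i, MemLp (e i) 2 μ) ∧ ∀ u : X → ℂ, MemLp u 2 μ →
    ∑' i, ‖∫ x, conj (e i x) * u x ∂μ‖ₑ ^ 2 = ∫⁻ x, ‖u x‖ₑ ^ 2 ∂μ

lemma tsum_enorm_sq_of_hasSum {a : ι → ℂ} {r : ℝ} (h : HasSum (fun i => ‖a i‖ ^ 2) r) :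
    ∑' i, ‖a i‖ₑ ^ 2 = ENNReal.ofReal r := by
  rw [← h.tsum_eq, ENNReal.ofReal_tsum_of_nonneg (fun i => by positivity) h.summable]
  refine tsum_congr fun i => ?_
  rw [ENNReal.ofReal_pow (norm_nonneg _), ofReal_norm]

lemma isParseval_of_isONBFun {e : ι → ℝ → ℂ} (h : IsONBFun e) : IsParseval volume e := by
  obtain ⟨b, hb⟩ := h
  refine ⟨fun i => (memLp_congr_ae (hb i)).1 (Lp.memLp _), fun u hu => ?_⟩
  have h1 := b.hasSum_inner_mul_inner (hu.toLp u) (hu.toLp u)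
  have h2 : HasSum (fun i => ‖inner ℂ (b i) (hu.toLp u)‖ ^ 2) (‖hu.toLp u‖ ^ 2) := by
    have := (RCLike.hasSum_re ℂ h1)
    convert this using 1
    · ext i
      rw [← inner_conj_symm, RCLike.mul_conj, RCLike.norm_conj]
      norm_cast
    · rw [inner_self_eq_norm_sq_to_K]
      norm_cast
  have h3 := tsum_enorm_sq_of_hasSum h2
  simp_rw [inner_toLp_eq (hb _) hu.coeFn_toLp] at h3
  rw [h3, ENNReal.ofReal_pow (norm_nonneg _), ofReal_norm, ← lintegral_enorm_sq_lp]
  refine lintegral_congr_ae ?_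
  filter_upwards [hu.coeFn_toLp] with x hx
  rw [hx]

lemma IsParseval.comp_measurePreserving {e : ι → Y → ℂ} (he : IsParseval ν e) (T : X ≃ᵐ Y)
    (hT : MeasurePreserving T μ ν) : IsParseval μ (fun i x => e i (T x)) := by
  refine ⟨fun i => (he.1 i).comp_measurePreserving hT, fun u hu => ?_⟩
  have h1 := he.2 (fun y => u (T.symm y)) (hu.comp_measurePreserving (hT.symm T))
  rw [(hT.symm T).lintegral_comp_emb T.symm.measurableEmbedding (fun x => ‖u x‖ₑ ^ 2)] at h1
  rw [← h1]
  refine tsum_congr fun i => ?_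
  rw [← hT.integral_comp' (g := fun y => conj (e i y) * u (T.symm y))]
  simp

lemma IsParseval.reindex {e : ι → X → ℂ} (he : IsParseval μ e) (σ : κ ≃ ι) :
    IsParseval μ (fun k => e (σ k)) := by
  refine ⟨fun k => he.1 _, fun u hu => ?_⟩
  rw [← he.2 u hu]
  exact σ.tsum_eq (fun i => ‖∫ x, conj (e i x) * u x ∂μ‖ₑ ^ 2)

lemma lintegral_comp_const_mul (F : ℝ → ℝ≥0∞) {c : ℝ} (hc : 0 < c) :
    ∫⁻ x, F (c * x) = ENNReal.ofReal c⁻¹ * ∫⁻ x, F x := by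
  have h := Real.map_volume_mul_left hc.ne'
  have h2 : ∫⁻ x, F (c * x) = ∫⁻ x, F x ∂(Measure.map (c * ·) volume) :=
    ((Homeomorph.mulLeft₀ c hc.ne').toMeasurableEquiv.measurableEmbedding.lintegral_map F).symm
  rw [h2, h, lintegral_smul_measure, abs_of_pos (inv_pos.2 hc), smul_eq_mul]

lemma MemLp.comp_const_mul {u : ℝ → ℂ} (hu : MemLp u 2 volume) {c : ℝ} (hc : 0 < c) :
    MemLp (fun x => u (c * x)) 2 volume := by
  have hm : AEStronglyMeasurable (fun x => u (c * x)) volume := by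
    refine hu.1.comp_quasiMeasurePreserving ⟨measurable_const_mul c, ?_⟩
    rw [Real.map_volume_mul_left hc.ne']
    exact Measure.smul_absolutelyContinuous
  rw [memLp_two_iff_lintegral hm, lintegral_comp_const_mul (fun x => ‖u x‖ₑ ^ 2) hc]
  exact ENNReal.mul_lt_top ENNReal.ofReal_lt_top ((memLp_two_iff_lintegral hu.1).1 hu)

lemma IsParseval.dilate {e : ι → ℝ → ℂ} (he : IsParseval volume e) {c : ℝ} (hc : 0 < c) :
    IsParseval volume (fun i x => ((√c : ℝ) : ℂ) * e i (c * x)) := by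
  refine ⟨fun i => (MemLp.comp_const_mul (he.1 i) hc).const_mul _, fun u hu => ?_⟩
  have hv : MemLp (fun x => ((√c : ℝ) : ℂ) * u (c * x)) 2 volume :=
    (MemLp.comp_const_mul hu hc).const_mul _
  have hu' := MemLp.comp_const_mul hu (inv_pos.2 hc)
  have key := he.2 (fun y => (((√c)⁻¹ : ℝ) : ℂ) * u (c⁻¹ * y)) (hu'.const_mul _)
  have hs : (0 : ℝ) < √c := Real.sqrt_pos.2 hc
  have hR : ∫⁻ y, ‖(((√c)⁻¹ : ℝ) : ℂ) * u (c⁻¹ * y)‖ₑ ^ 2 = ∫⁻ x, ‖u x‖ₑ ^ 2 := by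
    simp_rw [enorm_mul, mul_pow]
    rw [lintegral_const_mul' _ _ (by simp), lintegral_comp_const_mul (fun x => ‖u x‖ₑ ^ 2)
      (inv_pos.2 hc), ← mul_assoc]
    have : ‖(((√c)⁻¹ : ℝ) : ℂ)‖ₑ ^ 2 * ENNReal.ofReal (c⁻¹)⁻¹ = 1 := by
      rw [← ofReal_norm, ← ENNReal.ofReal_pow (norm_nonneg _), ← ENNReal.ofReal_mul (by positivity)]
      rw [Complex.norm_real, Real.norm_of_nonneg (by positivity), inv_pow, Real.sq_sqrt hc.le, inv_inv,
        inv_mul_cancel₀ hc.ne', ENNReal.ofReal_one]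
    rw [this, one_mul]
  rw [← hR, ← key]
  refine tsum_congr fun i => ?_
  congr 2
  have := Measure.integral_comp_mul_left
    (fun y => conj (((√c : ℝ) : ℂ) * e i y) * u (c⁻¹ * y)) c
  simp only [inv_mul_cancel_left₀ hc.ne'] at this
  rw [this, abs_of_pos (inv_pos.2 hc), ← integral_smul]
  congr 1
  ext y
  rw [map_mul, Complex.conj_ofReal, Complex.real_smul]
  have h3 : ((c⁻¹ : ℝ) : ℂ) * ((√c : ℝ) : ℂ) = (((√c)⁻¹ : ℝ) : ℂ) := by
    rw [← Complex.ofReal_mul]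
    congr 1
    field_simp
    exact Real.sq_sqrt hc.le
  rw [← h3]
  ring

/-- Products of a Parseval family in the first variable with Parseval families in the second
variable, which may depend on the index of the first factor, form a Parseval family. -/
lemma IsParseval.tensor [SFinite μ] [SFinite ν] [Countable ι] {e : ι → X → ℂ} {f : ι → κ → Y → ℂ}
    (he : IsParseval μ e) (hf : ∀ i, IsParseval ν (f i)) :
    IsParseval (μ.prod ν) (fun (i : ι × κ) z => e i.1 z.1 * f i.1 i.2 z.2) := by
  have hmem : ∀ i : ι × κ, MemLp (fun z : X × Y => e i.1 z.1 * f i.1 i.2 z.2) 2 (μ.prod ν) := by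
    intro i
    have hm : AEStronglyMeasurable (fun z : X × Y => e i.1 z.1 * f i.1 i.2 z.2) (μ.prod ν) :=
      (he.1 i.1).1.comp_fst.mul ((hf i.1).1 i.2).1.comp_snd
    rw [memLp_two_iff_lintegral hm]
    simp_rw [enorm_mul, mul_pow]
    rw [lintegral_prod_mul ((he.1 i.1).1.enorm.pow_const 2) (((hf i.1).1 i.2).1.enorm.pow_const 2)]
    exact ENNReal.mul_lt_top ((memLp_two_iff_lintegral (he.1 _).1).1 (he.1 _))
      ((memLp_two_iff_lintegral ((hf _).1 _).1).1 ((hf _).1 _))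
  refine ⟨hmem, fun F hF => ?_⟩
  have hFm : AEMeasurable (fun z : X × Y => ‖F z‖ₑ ^ 2) (μ.prod ν) := hF.1.enorm.pow_const 2
  have hFfin := (memLp_two_iff_lintegral hF.1).1 hF
  -- almost every horizontal slice of `F` is square integrable
  have hslice : ∀ᵐ y ∂ν, MemLp (fun x => F (x, y)) 2 μ := by
    have h1 : ∀ᵐ y ∂ν, ∫⁻ x, ‖F (x, y)‖ₑ ^ 2 ∂μ < ∞ := by
      refine ae_lt_top' hFm.lintegral_prod_left' ?_
      rw [← lintegral_prod_symm _ hFm]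
      exact hFfin.ne
    have h2 : ∀ᵐ y ∂ν, AEStronglyMeasurable (fun x => F (x, y)) μ := hF.1.prod_swap.prodMk_left
    filter_upwards [h1, h2] with y hy1 hy2
    exact (memLp_two_iff_lintegral hy2).2 hy1
  have hcm : ∀ i, AEStronglyMeasurable (fun z : Y × X => conj (e i z.2) * F (z.2, z.1))
      (ν.prod μ) := fun i =>
    (RCLike.continuous_conj.comp_aestronglyMeasurable (he.1 i).1.comp_snd).mul hF.1.prod_swap
  have hcoef : ∀ i, AEStronglyMeasurable (fun y => ∫ x, conj (e i x) * F (x, y) ∂μ) ν :=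
    fun i => (hcm i).integral_prod_right'
  have hsum : ∑' i, ∫⁻ y, ‖∫ x, conj (e i x) * F (x, y) ∂μ‖ₑ ^ 2 ∂ν
      = ∫⁻ z, ‖F z‖ₑ ^ 2 ∂(μ.prod ν) := by
    rw [← lintegral_tsum fun i => (hcoef i).enorm.pow_const 2, lintegral_prod_symm _ hFm]
    refine lintegral_congr_ae ?_
    filter_upwards [hslice] with y hy
    exact he.2 _ hy
  have hcoefLp : ∀ i, MemLp (fun y => ∫ x, conj (e i x) * F (x, y) ∂μ) 2 ν := fun i =>
    (memLp_two_iff_lintegral (hcoef i)).2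
      (((ENNReal.le_tsum i).trans hsum.le).trans_lt hFfin)
  rw [ENNReal.tsum_prod', ← hsum]
  refine tsum_congr fun i => ?_
  rw [← (hf i).2 _ (hcoefLp i)]
  refine tsum_congr fun k => ?_
  congr 2
  have hint : Integrable (fun z : X × Y => conj (e i z.1 * f i k z.2) * F z) (μ.prod ν) := by
    have h := (MemLp.star (hmem (i, k))).integrable_mul hF
    exact h
  rw [integral_prod_symm _ hint]
  refine integral_congr_ae (Filter.Eventually.of_forall fun y => ?_)
  dsimp only
  rw [← integral_const_mul]
  refine integral_congr_ae (Filter.Eventually.of_forall fun x => ?_)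
  dsimp only
  rw [map_mul]
  ring

end Parseval

/-! ### The shearlet-type wavelet systems -/

/-- The plane as a product of two lines. -/
def planeProd : Plane ≃ᵐ ℝ × ℝ :=
  (MeasurableEquiv.toLp 2 (Fin 2 → ℝ)).symm.trans MeasurableEquiv.finTwoArrow

lemma planeProd_apply (x : Plane) : planeProd x = (x 0, x 1) := rfl

lemma measurePreserving_planeProd : MeasurePreserving planeProd volume volume :=
  (volume_preserving_finTwoArrow ℝ).comp
    (EuclideanSpace.volume_preserving_symm_measurableEquiv_toLp (Fin 2))

/-- The shear `S_s` on the product of two lines. -/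
def shearProd (s : ℝ) : ℝ × ℝ ≃ᵐ ℝ × ℝ where
  toFun z := (z.1 + s * z.2, z.2)
  invFun z := (z.1 - s * z.2, z.2)
  left_inv z := by simp
  right_inv z := by simp
  measurable_toFun := by
    change Measurable fun z : ℝ × ℝ => (z.1 + s * z.2, z.2)
    fun_prop
  measurable_invFun := by
    change Measurable fun z : ℝ × ℝ => (z.1 - s * z.2, z.2)
    fun_prop

lemma measurePreserving_shearProd (s : ℝ) : MeasurePreserving (shearProd s) volume volume := by
  have h : MeasurePreserving (fun p : ℝ × ℝ => (p.1, p.2 + s * p.1)) (volume.prod volume)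
      (volume.prod volume) :=
    (MeasurePreserving.id volume).skew_product (g := fun a c => c + s * a)
      (by unfold Function.uncurry; fun_prop)
      (Filter.Eventually.of_forall fun a => map_add_right_eq_self volume (s * a))
  exact (Measure.measurePreserving_swap.comp h).comp Measure.measurePreserving_swap

lemma act_apply (M : Matrix (Fin 2) (Fin 2) ℝ) (x : Plane) (i : Fin 2) :
    act M x i = M i 0 * x 0 + M i 1 * x 1 := by
  simp [act, Matrix.mulVec, dotProduct, Fin.sum_univ_two]

lemma sqrt_two_pow (n : ℕ) : √((2 : ℝ) ^ n) = (2 : ℝ) ^ ((n : ℝ) / 2) := by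
  rw [Real.sqrt_eq_rpow, ← Real.rpow_natCast, ← Real.rpow_mul (by norm_num)]
  congr 1
  ring

/-- The factor of the elements of the `s`-th wavelet system that depends on the first sheared
coordinate; it is the basis `waveletFun` dilated by `2^j₀`. -/
def scaleFactor (φ₁ ψ₁ : ℝ → ℂ) (s : ℝ) : ScaleIdx s × ℤ → ℝ → ℂ
  | (none, m), x => ((√(2 ^ startScale s) : ℝ) : ℂ) * φ₁ (2 ^ startScale s * x - m)
  | (some j, m), x => ((√(2 ^ (j : ℕ)) : ℝ) : ℂ) * ψ₁ (2 ^ (j : ℕ) * x - m)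

/-- The scale of the matrix `A_j` used at a scale index; index `-1` uses `A_{j₀}`. -/
def scaleOf {s : ℝ} : ScaleIdx s → ℕ
  | none => startScale s
  | some j => j

/-- The pairs `(p, m₂)` enumerate the wavelet basis: `p = 0` stands for the translates of `φ₁`, and
`p + 1` for the wavelets of scale `p`. -/
def overIdx : ℕ × ℤ ≃ ℤ ⊕ (ℕ × ℤ) where
  toFun
    | (0, m) => Sum.inl m
    | (p + 1, m) => Sum.inr (p, m)
  invFun
    | Sum.inl m => (0, m)
    | Sum.inr (p, m) => (p + 1, m)
  left_inv := by rintro ⟨_ | p, m⟩ <;> rfl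
  right_inv := by rintro (m | ⟨p, m⟩) <;> rfl

/-- The pairs of a scale index and `m₁` enumerate the wavelet basis dilated by `2^j₀`: scale `j` comes
from the wavelets of scale `j - j₀`. -/
def scaleIdxEquiv (s : ℝ) : ScaleIdx s × ℤ ≃ ℤ ⊕ (ℕ × ℤ) where
  toFun
    | (none, m) => Sum.inl m
    | (some j, m) => Sum.inr (j - startScale s, m)
  invFun
    | Sum.inl m => (none, m)
    | Sum.inr (p, m) => (some ⟨startScale s + p, Nat.le_add_right _ _⟩, m)
  left_inv := by
    rintro ⟨_ | ⟨j, hj⟩, m⟩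
    · rfl
    · simp [Nat.add_sub_cancel' hj]
  right_inv := by
    rintro (m | ⟨p, m⟩)
    · rfl
    · simp

lemma isParseval_scaleFactor {φ₁ ψ₁ : ℝ → ℂ} (h : IsParseval volume (waveletFun φ₁ ψ₁)) (s : ℝ) :
    IsParseval volume (scaleFactor φ₁ ψ₁ s) := by
  have h1 := (h.dilate (c := 2 ^ startScale s) (by positivity)).reindex (scaleIdxEquiv s)
  convert h1 using 1
  ext ⟨_ | ⟨j, hj⟩, m⟩ x
  · simp [scaleFactor, scaleIdxEquiv, waveletFun]
  · obtain ⟨p, rfl⟩ := Nat.exists_eq_add_of_le hj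
    simp only [scaleFactor, scaleIdxEquiv, waveletFun, Equiv.coe_fn_mk, Nat.add_sub_cancel_left]
    rw [← sqrt_two_pow, pow_add, Real.sqrt_mul (by positivity)]
    push_cast
    rw [mul_assoc, ← mul_assoc ((2 : ℝ) ^ p), mul_comm ((2 : ℝ) ^ p)]

lemma dilate_liftFun_zero (φ₁ ψ₁ h : ℝ → ℂ) (j : ℕ) (s : ℝ) (m : ℤ × ℤ) (x : Plane) :
    dilate (liftFun φ₁ ψ₁ h 0) j s m 0 x =
      (((√(2 ^ j) : ℝ) : ℂ) * h (2 ^ j * (x 0 + s * x 1) - m.1)) *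
      (((√(2 ^ (j / 2)) : ℝ) : ℂ) * φ₁ (2 ^ (j / 2) * x 1 - m.2)) := by
  have hdet : |(scaleMat j).det| = 2 ^ j * 2 ^ (j / 2) := by
    rw [scaleMat, Matrix.det_fin_two_of, abs_of_nonneg] <;> simp
  rw [dilate, hdet, Real.sqrt_mul (by positivity), liftFun]
  simp [act_apply, scaleMat, shearMat, overMat, latticePt]
  ring_nf

lemma dilate_liftFun_succ (φ₁ ψ₁ h : ℝ → ℂ) (j : ℕ) (s : ℝ) (m : ℤ × ℤ) (p : ℕ) (x : Plane) :
    dilate (liftFun φ₁ ψ₁ h (p + 1)) j s m (p + 1) x =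
      (((√(2 ^ j) : ℝ) : ℂ) * h (2 ^ j * (x 0 + s * x 1) - m.1)) *
      (((√(2 ^ (j / 2)) : ℝ) : ℂ) * ((((2 : ℝ) ^ ((p : ℝ) / 2) : ℝ) : ℂ) *
        ψ₁ (2 ^ p * (2 ^ (j / 2) * x 1) - m.2))) := by
  have hdet : |(scaleMat j).det| = 2 ^ j * 2 ^ (j / 2) := by
    rw [scaleMat, Matrix.det_fin_two_of, abs_of_nonneg] <;> simp
  have h0 : (act (scaleMat j * shearMat s) x - act (overMat (p + 1)) (latticePt m)) 0
      = 2 ^ j * (x 0 + s * x 1) - m.1 := by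
    simp [act_apply, scaleMat, shearMat, overMat, latticePt]
    ring
  have h1 : 2 ^ p * (act (scaleMat j * shearMat s) x - act (overMat (p + 1)) (latticePt m)) 1
      = 2 ^ p * (2 ^ (j / 2) * x 1) - m.2 := by
    simp [act_apply, scaleMat, shearMat, overMat, latticePt]
    field_simp
  rw [dilate, hdet, Real.sqrt_mul (by positivity)]
  simp only [liftFun, h0, h1]
  push_cast
  ring

lemma isParseval_waveletElt {φ₁ ψ₁ : ℝ → ℂ} (h : IsONBFun (waveletFun φ₁ ψ₁)) (s : ℝ) :
    IsParseval volume (waveletElt φ₁ ψ₁ s) := by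
  have hW := isParseval_of_isONBFun h
  have hF : ∀ i : ScaleIdx s × ℤ, IsParseval volume (fun (k : ℕ × ℤ) (y : ℝ) =>
      ((√(2 ^ (scaleOf i.1 / 2)) : ℝ) : ℂ) *
        waveletFun φ₁ ψ₁ (overIdx k) (2 ^ (scaleOf i.1 / 2) * y)) := fun i =>
    (hW.dilate (by positivity)).reindex overIdx
  have h1 := ((isParseval_scaleFactor hW s).tensor hF).comp_measurePreserving
    (planeProd.trans (shearProd s))
    ((measurePreserving_shearProd s).comp measurePreserving_planeProd)
  let σ : Lam s ≃ (ScaleIdx s × ℤ) × (ℕ × ℤ) :=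
    { toFun := fun l => ((l.1, l.2.1.1), (l.2.2, l.2.1.2))
      invFun := fun k => (k.1.1, (k.1.2, k.2.2), k.2.1)
      left_inv := fun _ => rfl
      right_inv := fun _ => rfl }
  refine (congrArg (IsParseval volume) ?_).mpr (h1.reindex σ)
  funext l x
  obtain ⟨_ | j, m, _ | p⟩ := l
  · exact dilate_liftFun_zero φ₁ ψ₁ φ₁ (startScale s) s m x
  · exact dilate_liftFun_succ φ₁ ψ₁ φ₁ (startScale s) s m p x
  · exact dilate_liftFun_zero φ₁ ψ₁ ψ₁ j s m x
  · exact dilate_liftFun_succ φ₁ ψ₁ ψ₁ j s m p x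

lemma fourier_liftFun_zero (φ₁ ψ₁ h : ℝ → ℂ) (ξ : Plane) :
    𝓕 (liftFun φ₁ ψ₁ h 0) ξ = 𝓕 h (ξ 0) * 𝓕 φ₁ (ξ 1) := by
  rw [Real.fourier_eq, Real.fourier_eq, Real.fourier_eq, ← integral_prod_mul]
  refine Eq.trans ?_ (measurePreserving_planeProd.integral_comp' (g := fun z : ℝ × ℝ =>
    (Real.fourierChar (-inner ℝ z.1 (ξ 0)) • h z.1) *
      (Real.fourierChar (-inner ℝ z.2 (ξ 1)) • φ₁ z.2)))
  refine integral_congr_ae (Filter.Eventually.of_forall fun x => ?_)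
  simp only [planeProd_apply, liftFun, Circle.smul_def, smul_eq_mul, Real.fourierChar_apply]
  have : inner ℝ x ξ = inner ℝ (x 0) (ξ 0) + inner ℝ (x 1) (ξ 1) := by
    simp [PiLp.inner_apply, Fin.sum_univ_two]
  rw [this, neg_add, mul_add]
  push_cast
  rw [add_mul, Complex.exp_add]
  ring

/-! ### Fourier multipliers on `L²(ℝ²)` -/

/-- `m` is essentially bounded and measurable, so that `fourierMul m` is a bounded operator. -/
def IsMultiplier (m : Plane → ℝ) : Prop :=
  AEStronglyMeasurable m volume ∧ ∃ C : ℝ, ∀ᵐ ξ, ‖m ξ‖ ≤ C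

lemma toL2_coe {F : Plane → ℂ} (h : MemLp F 2 volume) : toL2 F =ᵐ[volume] F := by
  rw [toL2, dif_pos h]
  exact h.coeFn_toLp

lemma IsMultiplier.memLp {m : Plane → ℝ} (hm : IsMultiplier m) (f : L2Plane) :
    MemLp (fun ξ => (m ξ : ℂ) * f ξ) 2 volume := by
  obtain ⟨h1, C, hC⟩ := hm
  refine (Lp.memLp f).of_le_mul (c := C)
    ((Complex.continuous_ofReal.comp_aestronglyMeasurable h1).mul (Lp.memLp f).1) ?_
  filter_upwards [hC] with ξ hξ
  rw [norm_mul, Complex.norm_real]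
  gcongr

lemma fourier_fourierMul {m : Plane → ℝ} (hm : IsMultiplier m) (f : L2Plane) :
    (𝓕 (fourierMul m f) : L2Plane) =ᵐ[volume] fun ξ => (m ξ : ℂ) * (𝓕 f : L2Plane) ξ := by
  rw [fourierMul, FourierTransform.fourier_fourierInv_eq]
  exact toL2_coe (hm.memLp _)

lemma ext_fourier {f g : L2Plane} (h : (𝓕 f : L2Plane) =ᵐ[volume] (𝓕 g : L2Plane)) : f = g :=
  (Lp.fourierTransformₗᵢ Plane ℂ).injective (Lp.ext h)

lemma fourierMul_add {m : Plane → ℝ} (hm : IsMultiplier m) (f g : L2Plane) :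
    fourierMul m (f + g) = fourierMul m f + fourierMul m g := by
  apply ext_fourier
  rw [FourierTransform.fourier_add]
  have h1 : (𝓕 (f + g) : L2Plane) = 𝓕 f + 𝓕 g := FourierTransform.fourier_add _ _
  filter_upwards [fourier_fourierMul hm (f + g), fourier_fourierMul hm f, fourier_fourierMul hm g,
    Lp.coeFn_add (𝓕 (fourierMul m f) : L2Plane) (𝓕 (fourierMul m g)),
    Lp.coeFn_add (𝓕 f : L2Plane) (𝓕 g)] with ξ a b c d e
  rw [a, d, Pi.add_apply, b, c, h1, e, Pi.add_apply, mul_add]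

lemma fourierMul_smul {m : Plane → ℝ} (hm : IsMultiplier m) (c : ℂ) (f : L2Plane) :
    fourierMul m (c • f) = c • fourierMul m f := by
  apply ext_fourier
  rw [FourierTransform.fourier_smul]
  have h1 : (𝓕 (c • f) : L2Plane) = c • 𝓕 f := FourierTransform.fourier_smul _ _
  filter_upwards [fourier_fourierMul hm (c • f), fourier_fourierMul hm f,
    Lp.coeFn_smul c (𝓕 (fourierMul m f) : L2Plane),
    Lp.coeFn_smul c (𝓕 f : L2Plane)] with ξ a b d e
  rw [a, d, Pi.smul_apply, b, h1, e, Pi.smul_apply, smul_eq_mul, smul_eq_mul]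
  ring

/-- The Fourier multiplier operator as a bounded linear operator. -/
def fourierMulCLM {m : Plane → ℝ} (hm : IsMultiplier m) : L2Plane →L[ℂ] L2Plane :=
  LinearMap.mkContinuous
    { toFun := fourierMul m
      map_add' := fourierMul_add hm
      map_smul' := fourierMul_smul hm } hm.2.choose (by
    intro f
    change ‖fourierMul m f‖ ≤ _
    rw [← Lp.norm_fourier_eq, ← Lp.norm_fourier_eq f]
    refine Lp.norm_le_mul_norm_of_ae_le_mul ?_
    filter_upwards [fourier_fourierMul hm f, hm.2.choose_spec] with ξ h1 h2
    rw [h1, norm_mul, Complex.norm_real]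
    gcongr)

lemma inner_fourierMul_left {m : Plane → ℝ} (hm : IsMultiplier m) (f g : L2Plane) :
    inner ℂ (fourierMul m f) g = inner ℂ f (fourierMul m g) := by
  rw [← Lp.inner_fourier_eq, ← Lp.inner_fourier_eq f, L2.inner_def, L2.inner_def]
  refine integral_congr_ae ?_
  filter_upwards [fourier_fourierMul hm f, fourier_fourierMul hm g] with ξ h1 h2
  rw [h1, h2]
  simp only [RCLike.inner_apply, map_mul, Complex.conj_ofReal]
  ring

lemma enorm_fourierMul {m : Plane → ℝ} (hm : IsMultiplier m) (f : L2Plane) :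
    ‖fourierMul m f‖ₑ ^ 2 = ∫⁻ ξ, ENNReal.ofReal (m ξ ^ 2) * ‖(𝓕 f : L2Plane) ξ‖ₑ ^ 2 := by
  have : ‖fourierMul m f‖ₑ = ‖(𝓕 (fourierMul m f) : L2Plane)‖ₑ := by
    rw [← ofReal_norm, ← ofReal_norm, Lp.norm_fourier_eq]
  rw [this, ← lintegral_enorm_sq_lp]
  refine lintegral_congr_ae ?_
  filter_upwards [fourier_fourierMul hm f] with ξ h1
  rw [h1, enorm_mul, mul_pow]
  congr 1
  rw [← ofReal_norm, ← ENNReal.ofReal_pow (norm_nonneg _), Complex.norm_real, Real.norm_eq_abs, sq_abs]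

/-! ### Rotation by a right angle -/

lemma rotL2_coe (f : L2Plane) : rotL2 f =ᵐ[volume] fun x => f (rot x) :=
  Lp.coeFn_compMeasurePreserving f rot.measurePreserving

/-- The rotation of functions as a linear isometry of `L²(ℝ²)`. -/
def rotL2ₗᵢ : L2Plane →ₗᵢ[ℂ] L2Plane := Lp.compMeasurePreservingₗᵢ ℂ rot rot.measurePreserving

lemma inner_rotL2 (f g : L2Plane) : inner ℂ (rotL2 f) (rotL2 g) = inner ℂ f g :=
  rotL2ₗᵢ.inner_map_map f g

lemma rotL2_surjective : Function.Surjective rotL2 := by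
  intro f
  refine ⟨Lp.compMeasurePreserving rot.symm rot.symm.measurePreserving f, ?_⟩
  apply Lp.ext
  have h := rot.measurePreserving.quasiMeasurePreserving.ae
    (Lp.coeFn_compMeasurePreserving f rot.symm.measurePreserving)
  filter_upwards [rotL2_coe (Lp.compMeasurePreserving rot.symm rot.symm.measurePreserving f), h]
    with x h1 h2
  rw [h1, h2]
  simp

/-- The Fourier transform commutes with the rotation. For Schwartz functions this is a change of
variables, and they are dense. -/
lemma fourier_rotL2 (f : L2Plane) : 𝓕 (rotL2 f) = rotL2 (𝓕 f) := by
  have hcont : Continuous rotL2 := rotL2ₗᵢ.continuous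
  refine DenseRange.induction_on (p := fun f : L2Plane => 𝓕 (rotL2 f) = rotL2 (𝓕 f))
    (SchwartzMap.denseRange_toLpCLM (F := ℂ) (p := 2) (μ := (volume : Measure Plane))
      ENNReal.ofNat_ne_top) f ?_ ?_
  · refine isClosed_eq ?_ ?_
    · exact (Lp.fourierTransformₗᵢ Plane ℂ).continuous.comp hcont
    · exact hcont.comp (Lp.fourierTransformₗᵢ Plane ℂ).continuous
  · intro u
    change 𝓕 (rotL2 (u.toLp 2)) = rotL2 (𝓕 (u.toLp 2))
    have key : ∀ v : SchwartzMap Plane ℂ, rotL2 (v.toLp 2) =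
        (SchwartzMap.compCLMOfContinuousLinearEquiv ℂ rot.toContinuousLinearEquiv v).toLp 2 := by
      intro v
      apply Lp.ext
      have h := rot.measurePreserving.quasiMeasurePreserving.ae (v.coeFn_toLp 2 volume)
      filter_upwards [rotL2_coe (v.toLp 2), h, SchwartzMap.coeFn_toLp
        (SchwartzMap.compCLMOfContinuousLinearEquiv ℂ rot.toContinuousLinearEquiv v) 2 volume]
        with x h1 h2 h3
      rw [h1, h2, h3]
      rfl
    rw [key, SchwartzMap.toLp_fourier_eq, SchwartzMap.toLp_fourier_eq, key]
    congr 1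
    ext ξ
    exact Real.fourier_comp_linearIsometry rot u ξ

lemma rotL2_fourierMul {m m' : Plane → ℝ} (hm : IsMultiplier m) (hm' : IsMultiplier m')
    (h : ∀ ξ, m' ξ = m (rot ξ)) (f : L2Plane) :
    rotL2 (fourierMul m f) = fourierMul m' (rotL2 f) := by
  apply ext_fourier
  rw [fourier_rotL2]
  have h1 := rot.measurePreserving.quasiMeasurePreserving.ae (fourier_fourierMul hm f)
  have h2 := fourier_fourierMul hm' (rotL2 f)
  rw [fourier_rotL2] at h2
  filter_upwards [rotL2_coe (𝓕 (fourierMul m f)), h1, h2, rotL2_coe (𝓕 f)] with ξ a b c d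
  rw [a, b, c, d, h]

/-! ### Fourier transforms of the generators and the filter terms -/

lemma MemLp.integrable_of_hasCompactSupport {E : Type*} [NormedAddCommGroup E]
    [InnerProductSpace ℝ E] [FiniteDimensional ℝ E] [MeasurableSpace E] [BorelSpace E]
    {f : E → ℂ} (hf : MemLp f 2 volume) (hc : HasCompactSupport f) : Integrable f volume := by
  have h1 : IntegrableOn f (tsupport f) volume := by
    have : IsFiniteMeasure (volume.restrict (tsupport f)) :=
      ⟨by rw [Measure.restrict_apply_univ]; exact hc.isCompact.measure_lt_top⟩
    exact (hf.restrict _).integrable one_le_two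
  exact (integrableOn_iff_integrable_of_support_subset (subset_tsupport f)).1 h1

lemma continuous_fourier {E : Type*} [NormedAddCommGroup E]
    [InnerProductSpace ℝ E] [FiniteDimensional ℝ E] [MeasurableSpace E] [BorelSpace E]
    {f : E → ℂ} (hf : Integrable f volume) : Continuous (𝓕 f) :=
  VectorFourier.fourierIntegral_continuous Real.continuous_fourierChar (by exact continuous_inner) hf

lemma filterTerm_eq (g : Plane → ℂ) (s : ℝ) (j : ℕ) (ξ : Plane) :
    filterTerm g s j ξ = ‖𝓕 g !₂[ξ 0 / 2 ^ j, (ξ 1 - s * ξ 0) / 2 ^ (j / 2)]‖ ^ 2 := by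
  have h1 : (scaleMat j)⁻¹ = !![((2 : ℝ) ^ j)⁻¹, 0; 0, ((2 : ℝ) ^ (j / 2))⁻¹] := by
    apply Matrix.inv_eq_right_inv
    ext a b
    fin_cases a <;> fin_cases b <;> simp [scaleMat]
  have h2 : ((shearMat s).transpose)⁻¹ = !![1, 0; -s, 1] := by
    apply Matrix.inv_eq_right_inv
    ext a b
    fin_cases a <;> fin_cases b <;> simp [shearMat, Matrix.mul_apply, Fin.sum_univ_two]
  have h3 : act ((scaleMat j)⁻¹ * ((shearMat s).transpose)⁻¹) ξ =
      !₂[ξ 0 / 2 ^ j, (ξ 1 - s * ξ 0) / 2 ^ (j / 2)] := by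
    rw [h1, h2]
    ext i
    rw [act_apply]
    fin_cases i
    · simp
      ring
    · simp
      ring
  rw [filterTerm, h3]

/-- The shear parameter is a multiple of `2^{-⌈j/2⌉}`, and `⌈j/2⌉ + ⌊j/2⌋ = j`, so in the rescaled
variables the shears become translations by integer multiples of the first coordinate. -/
lemma filterTerm_div (g : Plane → ℂ) (j : ℕ) (q : ℤ) (ξ : Plane) :
    filterTerm g ((q : ℝ) / 2 ^ ((j + 1) / 2)) j ξ =
      ‖𝓕 g !₂[ξ 0 / 2 ^ j, ξ 1 / 2 ^ (j / 2) - q * (ξ 0 / 2 ^ j)]‖ ^ 2 := by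
  have h : (2 : ℝ) ^ j = 2 ^ ((j + 1) / 2) * 2 ^ (j / 2) := by
    rw [← pow_add]
    congr 1
    omega
  have h2 : (ξ 1 - (q : ℝ) / 2 ^ ((j + 1) / 2) * ξ 0) / 2 ^ (j / 2) =
      ξ 1 / 2 ^ (j / 2) - q * (ξ 0 / 2 ^ j) := by
    rw [h]
    field_simp
  rw [filterTerm_eq, h2]

lemma filterTerm_nonneg (g : Plane → ℂ) (s : ℝ) (j : ℕ) (ξ : Plane) : 0 ≤ filterTerm g s j ξ := by
  unfold filterTerm
  positivity

lemma filterHat_nonneg (φ₁ ψ₁ : ℝ → ℂ) (g : Plane → ℂ) (s : ℝ) (ξ : Plane) :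
    0 ≤ filterHat φ₁ ψ₁ g s ξ := by
  unfold filterHat
  refine add_nonneg (by split_ifs <;> positivity) (tsum_nonneg fun j => filterTerm_nonneg _ _ _ _)

/-! ### Shear parameters -/

lemma div_two_pow_mem_shearSet (k : ℕ) (q : ℤ) (hq : |q| ≤ 2 ^ k) :
    (q : ℝ) / 2 ^ k ∈ shearSet := by
  induction k generalizing q with
  | zero =>
    rcases Int.even_or_odd q with h | h
    · left
      have : q = 0 := by
        obtain ⟨r, rfl⟩ := h
        rw [abs_le] at hq
        norm_num at hq
        omega
      simp [this]
    · exact Or.inr ⟨0, q, h, hq, rfl⟩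
  | succ k ih =>
    rcases Int.even_or_odd q with h | h
    · obtain ⟨r, rfl⟩ := h
      have h1 : |r| ≤ 2 ^ k := by
        rw [← two_mul, abs_mul, pow_succ, abs_two] at hq
        omega
      convert ih r h1 using 1
      push_cast
      field_simp
      ring
    · exact Or.inr ⟨k + 1, q, h, hq, rfl⟩

lemma exists_eq_div_of_startScale_le {s : ℝ} (hs : s ∈ shearSet) {j : ℕ} (hj : startScale s ≤ j) :
    ∃ q : ℤ, s = (q : ℝ) / 2 ^ ((j + 1) / 2) := by
  have hne : {j : ℕ | ∃ q : ℤ, s = (q : ℝ) / 2 ^ ((j + 1) / 2)}.Nonempty := by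
    rcases hs with rfl | ⟨k, q, -, -, rfl⟩
    · exact ⟨0, 0, by simp⟩
    · refine ⟨2 * k, q, ?_⟩
      congr 2
      omega
  obtain ⟨q, hq⟩ := Nat.sInf_mem hne
  obtain ⟨d, hd⟩ := Nat.exists_eq_add_of_le
    (show (startScale s + 1) / 2 ≤ (j + 1) / 2 from Nat.div_le_div_right (by omega))
  refine ⟨q * 2 ^ d, ?_⟩
  rw [hd, pow_add]
  push_cast
  rw [mul_div_mul_right _ _ (by positivity)]
  exact hq

instance countable_shearSet : Countable shearSet := by
  have h : shearSet ⊆ Set.range (fun p : ℕ × ℤ => (p.2 : ℝ) / 2 ^ p.1) := by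
    rintro s (rfl | ⟨k, q, -, -, rfl⟩)
    · exact ⟨(0, 0), by simp⟩
    · exact ⟨(k, q), rfl⟩
  exact ((Set.countable_range _).mono h).to_subtype

/-! ### Upper bounds for the filters -/

/-- The weight `|a| / (1 + |a|)²`, whose sums over dyadic scales are bounded. -/
def dyadicWeight (a : ℝ) : ℝ := |a| / (1 + |a|) ^ 2

lemma dyadicWeight_nonneg (a : ℝ) : 0 ≤ dyadicWeight a := by unfold dyadicWeight; positivity

lemma tsum_dyadicWeight_le (x : ℝ) : ∑' j : ℕ, ENNReal.ofReal (dyadicWeight (x / 2 ^ j)) ≤ 2 := by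
  -- the weight is dominated by the increments of `a / (1 + a)` between consecutive scales
  have key : ∀ a : ℝ, 0 ≤ a → a / (1 + a) ^ 2 ≤ 2 * (a / (1 + a) - (a / 2) / (1 + a / 2)) := by
    intro a ha
    have : 2 * (a / (1 + a) - (a / 2) / (1 + a / 2)) - a / (1 + a) ^ 2
        = a ^ 2 / ((1 + a) ^ 2 * (2 + a)) := by
      field_simp
      ring
    have h2 : 0 ≤ a ^ 2 / ((1 + a) ^ 2 * (2 + a)) := by positivity
    linarith
  have hsum : ∀ N : ℕ, ∑ j ∈ Finset.range N, dyadicWeight (x / 2 ^ j) ≤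
      2 * (|x| / (1 + |x|) - (|x| / 2 ^ N) / (1 + |x| / 2 ^ N)) := by
    intro N
    induction N with
    | zero => simp
    | succ N ih =>
      rw [Finset.sum_range_succ]
      have h1 := key (|x| / 2 ^ N) (by positivity)
      have h2 : dyadicWeight (x / 2 ^ N) = |x| / 2 ^ N / (1 + |x| / 2 ^ N) ^ 2 := by
        rw [dyadicWeight, abs_div, abs_of_pos (show (0 : ℝ) < 2 ^ N by positivity)]
      have h3 : |x| / 2 ^ (N + 1) = |x| / 2 ^ N / 2 := by rw [pow_succ]; field_simp
      rw [h2, h3]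
      linarith
  refine ENNReal.tsum_le_of_sum_range_le fun N => ?_
  rw [← ENNReal.ofReal_sum_of_nonneg fun j _ => dyadicWeight_nonneg _]
  refine ENNReal.ofReal_le_of_le_toReal ((hsum N).trans ?_)
  have h1 : |x| / (1 + |x|) ≤ 1 := by
    rw [div_le_one (by positivity)]
    linarith
  have h2 : 0 ≤ (|x| / 2 ^ N) / (1 + |x| / 2 ^ N) := by positivity
  simp
  linarith

lemma summable_inv_sq_one_add_abs : Summable fun q : ℤ => 1 / (1 + |(q : ℝ)|) ^ 2 := by
  have h := (Real.summable_one_div_int_add_rpow (1 / 2) 2).2 (by norm_num)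
  refine h.of_nonneg_of_le (fun q => by positivity) fun q => ?_
  have h0 : 0 < |(q : ℝ) + 1 / 2| := by
    rw [abs_pos]
    intro h
    have h' : ((2 * q + 1 : ℤ) : ℝ) = 0 := by push_cast; linarith
    have h'' : (2 * q + 1 : ℤ) = 0 := by exact_mod_cast h'
    omega
  rw [Real.rpow_two]
  have h1 : |(q : ℝ) + 1 / 2| ≤ 1 + |(q : ℝ)| := by
    refine (abs_add_le _ _).trans ?_
    rw [abs_of_pos (by norm_num : (0 : ℝ) < 1 / 2)]
    linarith
  gcongr

/-- The part of the decay of `ĝ` that is used. The factor `min 1 a²` compensates for the number of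
shears when `a` is small, see `min_sq_div_le`. -/
lemma exists_fourier_bound {φ₁ ψ₁ : ℝ → ℂ} {g : Plane → ℂ} (hgen : IsGenerator φ₁ ψ₁ g) :
    ∃ K : ℝ, 0 ≤ K ∧ ∀ a b : ℝ, ‖𝓕 g !₂[a, b]‖ ^ 2 ≤
      K * (dyadicWeight a * (min 1 (a ^ 2) / (1 + |b|) ^ 2)) := by
  obtain ⟨ρ, α, β, hρ, hρ', hα, hβ, C, hC⟩ := hgen.decay
  have hα2 : 2 ≤ α := by
    have : 6 ≤ 6 / ρ := by
      rw [le_div_iff₀ hρ]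
      linarith
    linarith
  refine ⟨|C| ^ 2, by positivity, fun a b => ?_⟩
  have h0 := (hC 0 (by norm_num)).2.2 !₂[a, b]
  simp only [iteratedDeriv_zero, Matrix.cons_val_zero, Matrix.cons_val_one] at h0
  have hpow : ∀ t : ℝ, 1 + |t| ≤ (1 + |t|) ^ β := fun t =>
    Real.self_le_rpow_of_one_le (by linarith [abs_nonneg t]) (by linarith)
  have hmin : min 1 (|a| ^ α) ≤ min 1 (a ^ 2) := by
    rcases le_total |a| 1 with h | h
    · refine min_le_min_left _ ?_
      have := Real.rpow_le_rpow_of_exponent_ge' (abs_nonneg a) h (by norm_num : (0 : ℝ) ≤ 2) hα2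
      rwa [Real.rpow_two, sq_abs] at this
    · refine (min_le_left _ _).trans (le_min le_rfl ?_)
      rw [← sq_abs]
      exact one_le_pow₀ h
  have hm0 : 0 ≤ min 1 (a ^ 2) := by positivity
  have h1 : ‖𝓕 g !₂[a, b]‖ ≤ |C| * (min 1 (a ^ 2) / ((1 + |a|) * (1 + |b|))) := by
    refine h0.trans ?_
    have hn : 0 ≤ min 1 (|a| ^ α) / ((1 + |a|) ^ β * (1 + |b|) ^ β) := by positivity
    refine (mul_le_mul_of_nonneg_right (le_abs_self C) hn).trans ?_
    gcongr
    · exact hpow a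
    · exact hpow b
  have h2 : min 1 (a ^ 2) ≤ |a| := by
    rcases le_total |a| 1 with h | h
    · refine (min_le_right _ _).trans ?_
      rw [← sq_abs]
      nlinarith [abs_nonneg a]
    · exact (min_le_left _ _).trans h
  calc ‖𝓕 g !₂[a, b]‖ ^ 2 ≤ (|C| * (min 1 (a ^ 2) / ((1 + |a|) * (1 + |b|)))) ^ 2 := by gcongr
    _ = |C| ^ 2 * (min 1 (a ^ 2) / (1 + |a|) ^ 2 * (min 1 (a ^ 2) / (1 + |b|) ^ 2)) := by
      field_simp
    _ ≤ _ := by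
      unfold dyadicWeight
      gcongr

/-- The points `c - q a`, `q ∈ ℤ`, compared with the integers: the prefactor `min 1 a²` makes up for
their density `1 / |a|`. -/
lemma min_sq_div_le {a c : ℝ} (ha : a ≠ 0) (q : ℤ) :
    min 1 (a ^ 2) / (1 + |c - q * a|) ^ 2 ≤ 4 * (1 / (1 + |((⌊c / a⌋ - q : ℤ) : ℝ)|) ^ 2) := by
  set t : ℝ := |c / a - q| with ht
  have ht0 : 0 ≤ t := abs_nonneg _
  have h1 : |c - q * a| = |a| * t := by
    rw [ht, ← abs_mul]
    congr 1
    field_simp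
  have h2 : 1 + |((⌊c / a⌋ - q : ℤ) : ℝ)| ≤ 2 * (1 + t) := by
    push_cast
    have h3 : |(⌊c / a⌋ : ℝ) - q| ≤ |(⌊c / a⌋ : ℝ) - c / a| + t := abs_sub_le _ _ _
    have h4 : |(⌊c / a⌋ : ℝ) - c / a| ≤ 1 := by
      rw [abs_le]
      constructor <;> linarith [Int.floor_le (c / a), Int.lt_floor_add_one (c / a)]
    linarith
  have h5 : min 1 (a ^ 2) * (1 + t) ^ 2 ≤ (1 + |c - q * a|) ^ 2 := by
    rw [h1]
    rcases le_total |a| 1 with h | h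
    · calc min 1 (a ^ 2) * (1 + t) ^ 2 ≤ |a| ^ 2 * (1 + t) ^ 2 := by
            rw [sq_abs]; gcongr; exact min_le_right _ _
        _ = (|a| + |a| * t) ^ 2 := by ring
        _ ≤ _ := by gcongr
    · calc min 1 (a ^ 2) * (1 + t) ^ 2 ≤ 1 * (1 + t) ^ 2 := by
            gcongr; exact min_le_left _ _
        _ = (1 + 1 * t) ^ 2 := by ring
        _ ≤ _ := by gcongr
  calc min 1 (a ^ 2) / (1 + |c - q * a|) ^ 2 ≤ 1 / (1 + t) ^ 2 := by
        rw [div_le_div_iff₀ (by positivity) (by positivity), one_mul]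
        exact h5
    _ = 4 * (1 / (2 * (1 + t)) ^ 2) := by field_simp; ring
    _ ≤ _ := by gcongr

/-- At one scale, the sum over all shears is bounded by the dyadic weight. -/
lemma tsum_shear_le {φ₁ ψ₁ : ℝ → ℂ} {g : Plane → ℂ} (hgen : IsGenerator φ₁ ψ₁ g) :
    ∃ L : ℝ≥0∞, L ≠ ∞ ∧ ∀ a c : ℝ,
      ∑' q : ℤ, ENNReal.ofReal (‖𝓕 g !₂[a, c - q * a]‖ ^ 2) ≤
        L * ENNReal.ofReal (dyadicWeight a) := by
  obtain ⟨K, hK, hb⟩ := exists_fourier_bound hgen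
  refine ⟨ENNReal.ofReal (4 * K * ∑' q : ℤ, 1 / (1 + |(q : ℝ)|) ^ 2), ENNReal.ofReal_ne_top,
    fun a c => ?_⟩
  -- for `a = 0` the points `c - q a` coincide, but there `ĝ` vanishes
  rcases eq_or_ne a 0 with rfl | ha
  · have h0 : ∀ b : ℝ, ‖𝓕 g !₂[(0 : ℝ), b]‖ ^ 2 ≤ 0 := fun b => by
      simpa [dyadicWeight] using hb 0 b
    simp_rw [fun b => ENNReal.ofReal_of_nonpos (h0 b)]
    simp
  · rw [mul_comm (4 * K), ENNReal.ofReal_mul (tsum_nonneg fun q => by positivity),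
      ENNReal.ofReal_tsum_of_nonneg (fun q => by positivity) summable_inv_sq_one_add_abs,
      ← (Equiv.subLeft ⌊c / a⌋).tsum_eq
        (fun q : ℤ => ENNReal.ofReal (1 / (1 + |(q : ℝ)|) ^ 2)), mul_assoc, ← ENNReal.tsum_mul_right]
    refine ENNReal.tsum_le_tsum fun q => ?_
    rw [← ENNReal.ofReal_mul (by positivity), ← ENNReal.ofReal_mul (by positivity)]
    refine ENNReal.ofReal_le_ofReal ((hb _ _).trans ?_)
    have h1 := min_sq_div_le (c := c) ha q
    rw [Equiv.subLeft_apply]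
    calc K * (dyadicWeight a * (min 1 (a ^ 2) / (1 + |c - q * a|) ^ 2))
        ≤ K * (dyadicWeight a * (4 * (1 / (1 + |((⌊c / a⌋ - q : ℤ) : ℝ)|) ^ 2))) := by
          have := dyadicWeight_nonneg a
          gcongr
      _ = _ := by ring

/-- The numerator `s 2^⌈j/2⌉` attached to a shear parameter `s` and a scale `j ≥ j₀(s)`. -/
def shearNum (i : Σ s : shearSet, {j : ℕ // startScale (s : ℝ) ≤ j}) : ℤ :=
  (exists_eq_div_of_startScale_le i.1.2 i.2.2).choose

lemma eq_shearNum_div (i : Σ s : shearSet, {j : ℕ // startScale (s : ℝ) ≤ j}) :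
    (i.1 : ℝ) = (shearNum i : ℝ) / 2 ^ (((i.2 : ℕ) + 1) / 2) :=
  (exists_eq_div_of_startScale_le i.1.2 i.2.2).choose_spec

lemma injective_scale_shearNum : Function.Injective
    fun i : Σ s : shearSet, {j : ℕ // startScale (s : ℝ) ≤ j} => ((i.2 : ℕ), shearNum i) := by
  intro i i' h
  have h1 : (i.2 : ℕ) = i'.2 := congrArg Prod.fst h
  have h2 : shearNum i = shearNum i' := congrArg Prod.snd h
  have h3 : (i.1 : ℝ) = i'.1 := by rw [eq_shearNum_div i, eq_shearNum_div i', h1, h2]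
  obtain ⟨s, j, hj⟩ := i
  obtain ⟨s', j', hj'⟩ := i'
  obtain rfl : s = s' := Subtype.ext h3
  obtain rfl : j = j' := h1
  rfl

lemma tsum_filterTerm_le {φ₁ ψ₁ : ℝ → ℂ} {g : Plane → ℂ} (hgen : IsGenerator φ₁ ψ₁ g) :
    ∃ B : ℝ≥0∞, B ≠ ∞ ∧ ∀ ξ : Plane,
      ∑' (s : shearSet) (j : {j : ℕ // startScale (s : ℝ) ≤ j}),
        ENNReal.ofReal (filterTerm g s j ξ) ≤ B := by
  obtain ⟨L, hL, hsum⟩ := tsum_shear_le hgen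
  refine ⟨L * 2, ENNReal.mul_ne_top hL (by norm_num), fun ξ => ?_⟩
  obtain ⟨F, hFdef⟩ : ∃ F : ℕ × ℤ → ℝ≥0∞, ∀ p, F p = ENNReal.ofReal
      (‖𝓕 g !₂[ξ 0 / 2 ^ p.1, ξ 1 / 2 ^ (p.1 / 2) - p.2 * (ξ 0 / 2 ^ p.1)]‖ ^ 2) := ⟨_, fun _ => rfl⟩
  have hF : ∀ i : (Σ s : shearSet, {j : ℕ // startScale (s : ℝ) ≤ j}),
      ENNReal.ofReal (filterTerm g i.1 i.2 ξ) = F (i.2, shearNum i) := by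
    intro i
    rw [hFdef, ← filterTerm_div, ← eq_shearNum_div]
  calc ∑' (s : shearSet) (j : {j : ℕ // startScale (s : ℝ) ≤ j}),
        ENNReal.ofReal (filterTerm g s j ξ)
      = ∑' i : (Σ s : shearSet, {j : ℕ // startScale (s : ℝ) ≤ j}),
        ENNReal.ofReal (filterTerm g i.1 i.2 ξ) :=
          (ENNReal.tsum_sigma' fun i : (Σ s : shearSet, {j : ℕ // startScale (s : ℝ) ≤ j}) =>
            ENNReal.ofReal (filterTerm g i.1 i.2 ξ)).symm
    _ = ∑' i : (Σ s : shearSet, {j : ℕ // startScale (s : ℝ) ≤ j}), F (i.2, shearNum i) :=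
        tsum_congr hF
    _ ≤ ∑' p, F p := ENNReal.tsum_comp_le_tsum_of_injective injective_scale_shearNum F
    _ = ∑' (j : ℕ) (q : ℤ), F (j, q) := ENNReal.tsum_prod'
    _ ≤ ∑' j : ℕ, L * ENNReal.ofReal (dyadicWeight (ξ 0 / 2 ^ j)) := by
        refine ENNReal.tsum_le_tsum fun j => ?_
        simp_rw [hFdef]
        exact hsum _ _
    _ = L * ∑' j : ℕ, ENNReal.ofReal (dyadicWeight (ξ 0 / 2 ^ j)) := ENNReal.tsum_mul_left
    _ ≤ L * 2 := by gcongr; exact tsum_dyadicWeight_le _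

/-! ### Convergence and measurability of the filters -/

lemma summable_of_tsum_ofReal_ne_top {ι : Type*} {f : ι → ℝ} (hf : ∀ i, 0 ≤ f i)
    (h : ∑' i, ENNReal.ofReal (f i) ≠ ∞) : Summable f := by
  have := ENNReal.summable_toReal h
  simpa only [ENNReal.toReal_ofReal (hf _)] using this

lemma summable_filterTerm {φ₁ ψ₁ : ℝ → ℂ} {g : Plane → ℂ} (hgen : IsGenerator φ₁ ψ₁ g)
    (s : shearSet) (ξ : Plane) :
    Summable fun j : {j : ℕ // startScale (s : ℝ) ≤ j} => filterTerm g s j ξ := by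
  obtain ⟨B, hB, h⟩ := tsum_filterTerm_le hgen
  exact summable_of_tsum_ofReal_ne_top (fun j => filterTerm_nonneg _ _ _ _)
    (ne_top_of_le_ne_top hB ((ENNReal.le_tsum s).trans (h ξ)))

lemma zero_mem_shearSet : (0 : ℝ) ∈ shearSet := Or.inl rfl

lemma tsum_filterHat_le {φ₁ ψ₁ : ℝ → ℂ} {g : Plane → ℂ} (hgen : IsGenerator φ₁ ψ₁ g) :
    ∃ B : ℝ≥0∞, B ≠ ∞ ∧ ∀ ξ : Plane,
      ∑' s : shearSet, ENNReal.ofReal (filterHat φ₁ ψ₁ g s ξ) ≤ B := by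
  classical
  obtain ⟨B, hB, h⟩ := tsum_filterTerm_le hgen
  set M : ℝ := ∫ x, ‖liftFun φ₁ ψ₁ φ₁ 0 x‖ with hM
  refine ⟨ENNReal.ofReal (M ^ 2) + B, ENNReal.add_ne_top.2 ⟨ENNReal.ofReal_ne_top, hB⟩, fun ξ => ?_⟩
  have hb : ‖𝓕 (liftFun φ₁ ψ₁ φ₁ 0) ξ‖ ≤ M :=
    VectorFourier.norm_fourierIntegral_le_integral_norm _ _ _ _ _
  have h1 : ∀ s : shearSet, ENNReal.ofReal (filterHat φ₁ ψ₁ g s ξ) ≤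
      (if s = ⟨0, zero_mem_shearSet⟩ then ENNReal.ofReal (M ^ 2) else 0) +
        ∑' j : {j : ℕ // startScale (s : ℝ) ≤ j}, ENNReal.ofReal (filterTerm g s j ξ) := by
    intro s
    rw [filterHat]
    refine ENNReal.ofReal_add_le.trans (add_le_add ?_ ?_)
    · by_cases hs : (s : ℝ) = 0
      · rw [if_pos hs, if_pos (Subtype.ext hs)]
        gcongr
      · rw [if_neg hs, ENNReal.ofReal_zero]
        exact zero_le
    · exact (ENNReal.ofReal_tsum_of_nonneg (fun j => filterTerm_nonneg _ _ _ _)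
        (summable_filterTerm hgen s ξ)).le
  refine (ENNReal.tsum_le_tsum h1).trans ?_
  rw [ENNReal.tsum_add, tsum_ite_eq]
  exact add_le_add le_rfl (h ξ)

lemma ennreal_tsum_sq_le {ι : Type*} (f : ι → ℝ≥0∞) : ∑' i, f i ^ 2 ≤ (∑' i, f i) ^ 2 := by
  rw [sq, ← ENNReal.tsum_mul_left]
  refine ENNReal.tsum_le_tsum fun i => ?_
  rw [sq]
  gcongr
  exact ENNReal.le_tsum i

lemma exists_filter_bound {φ₁ ψ₁ : ℝ → ℂ} {g : Plane → ℂ} (hgen : IsGenerator φ₁ ψ₁ g) :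
    ∃ B : ℝ, 0 ≤ B ∧ (∀ (s : shearSet) (ξ : Plane), filterHat φ₁ ψ₁ g s ξ ≤ B) ∧
      ∀ ξ : Plane, Summable (fun s : shearSet =>
        filterHat φ₁ ψ₁ g s ξ ^ 2 + filterHat φ₁ ψ₁ g s (rot ξ) ^ 2) ∧
        filterSum φ₁ ψ₁ g ξ ≤ B ^ 2 + B ^ 2 := by
  obtain ⟨B, hB, h⟩ := tsum_filterHat_le hgen
  have hsq : ∀ ξ : Plane, ∑' s : shearSet, ENNReal.ofReal (filterHat φ₁ ψ₁ g s ξ ^ 2) ≤ B ^ 2 := by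
    intro ξ
    simp_rw [ENNReal.ofReal_pow (filterHat_nonneg _ _ _ _ _)]
    exact (ennreal_tsum_sq_le _).trans (by gcongr; exact h ξ)
  have hsum : ∀ ξ : Plane, ∑' s : shearSet, ENNReal.ofReal
      (filterHat φ₁ ψ₁ g s ξ ^ 2 + filterHat φ₁ ψ₁ g s (rot ξ) ^ 2) ≤ B ^ 2 + B ^ 2 := by
    intro ξ
    simp_rw [ENNReal.ofReal_add (sq_nonneg _) (sq_nonneg _)]
    rw [ENNReal.tsum_add]
    exact add_le_add (hsq _) (hsq _)
  have hfin : B ^ 2 + B ^ 2 ≠ ∞ := ENNReal.add_ne_top.2 ⟨ENNReal.pow_ne_top hB, ENNReal.pow_ne_top hB⟩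
  refine ⟨B.toReal, ENNReal.toReal_nonneg, fun s ξ => ?_, fun ξ => ⟨?_, ?_⟩⟩
  · rw [← ENNReal.ofReal_le_iff_le_toReal hB]
    exact (ENNReal.le_tsum s).trans (h ξ)
  · exact summable_of_tsum_ofReal_ne_top (fun s => by positivity)
      (ne_top_of_le_ne_top hfin (hsum ξ))
  · have h1 : Summable (fun s : shearSet =>
        filterHat φ₁ ψ₁ g s ξ ^ 2 + filterHat φ₁ ψ₁ g s (rot ξ) ^ 2) :=
      summable_of_tsum_ofReal_ne_top (fun s => by positivity)
        (ne_top_of_le_ne_top hfin (hsum ξ))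
    have h2 := hsum ξ
    rw [← ENNReal.ofReal_tsum_of_nonneg (fun s => by positivity) h1,
      ENNReal.ofReal_le_iff_le_toReal hfin, ENNReal.toReal_add (ENNReal.pow_ne_top hB)
      (ENNReal.pow_ne_top hB), ENNReal.toReal_pow] at h2
    exact h2

lemma measurable_tsum_of_nonneg {X ι : Type*} [MeasurableSpace X] [Countable ι] {f : ι → X → ℝ}
    (hm : ∀ i, Measurable (f i)) (h0 : ∀ i x, 0 ≤ f i x) (hs : ∀ x, Summable fun i => f i x) :
    Measurable fun x => ∑' i, f i x := by
  have : (fun x => ∑' i, f i x) = fun x => (∑' i, ENNReal.ofReal (f i x)).toReal := by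
    funext x
    rw [← ENNReal.ofReal_tsum_of_nonneg (fun i => h0 i x) (hs x),
      ENNReal.toReal_ofReal (tsum_nonneg fun i => h0 i x)]
  rw [this]
  exact (Measurable.tsum fun i => (hm i).ennreal_ofReal).ennreal_toReal

lemma measurable_filterHat {φ₁ ψ₁ : ℝ → ℂ} {g : Plane → ℂ} (hgen : IsGenerator φ₁ ψ₁ g)
    (s : shearSet) : Measurable (filterHat φ₁ ψ₁ g s) := by
  have hg : Continuous (𝓕 g) :=
    continuous_fourier (MemLp.integrable_of_hasCompactSupport hgen.memLp_g hgen.compact_g)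
  have hφ : Continuous (𝓕 φ₁) :=
    continuous_fourier (MemLp.integrable_of_hasCompactSupport hgen.memLp_phi hgen.compact_phi)
  have h1 : Continuous (𝓕 (liftFun φ₁ ψ₁ φ₁ 0)) := by
    rw [show 𝓕 (liftFun φ₁ ψ₁ φ₁ 0) = fun ξ => 𝓕 φ₁ (ξ 0) * 𝓕 φ₁ (ξ 1) from
      funext (fourier_liftFun_zero φ₁ ψ₁ φ₁)]
    fun_prop
  have h2 : ∀ j : {j : ℕ // startScale (s : ℝ) ≤ j}, Measurable (filterTerm g s j) := by
    intro j
    have : Continuous (filterTerm g s j) := by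
      unfold filterTerm act
      have := LinearMap.continuous_of_finiteDimensional
        (Matrix.toEuclideanLin ((scaleMat j)⁻¹ * ((shearMat s).transpose)⁻¹))
      fun_prop
    exact this.measurable
  have h3 := measurable_tsum_of_nonneg h2 (fun j ξ => filterTerm_nonneg _ _ _ _)
    (summable_filterTerm hgen s)
  unfold filterHat
  refine Measurable.add ?_ h3
  split_ifs
  · exact (h1.norm.pow 2).measurable
  · exact measurable_const

lemma measurable_filterSum {φ₁ ψ₁ : ℝ → ℂ} {g : Plane → ℂ} (hgen : IsGenerator φ₁ ψ₁ g) :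
    Measurable (filterSum φ₁ ψ₁ g) := by
  obtain ⟨B, -, -, hB⟩ := exists_filter_bound hgen
  refine measurable_tsum_of_nonneg (fun s => ?_) (fun s ξ => by positivity) (fun ξ => (hB ξ).1)
  have h := measurable_filterHat hgen s
  exact (h.pow_const 2).add ((h.comp rot.continuous.measurable).pow_const 2)

/-! ### The lower bound for the denominator -/

lemma filterTerm_le_filterHat {φ₁ ψ₁ : ℝ → ℂ} {g : Plane → ℂ} (hgen : IsGenerator φ₁ ψ₁ g)
    (s : shearSet) {j : ℕ} (hj : startScale (s : ℝ) ≤ j) (ξ : Plane) :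
    filterTerm g s j ξ ≤ filterHat φ₁ ψ₁ g s ξ := by
  have h := (summable_filterTerm hgen s ξ).le_tsum ⟨j, hj⟩ (fun j _ => filterTerm_nonneg _ _ _ _)
  refine h.trans ?_
  rw [filterHat]
  exact le_add_of_nonneg_left (by split_ifs <;> positivity)

lemma sq_le_filterHat_zero {φ₁ ψ₁ : ℝ → ℂ} {g : Plane → ℂ} (ξ : Plane) :
    (‖𝓕 φ₁ (ξ 0)‖ * ‖𝓕 φ₁ (ξ 1)‖) ^ 2 ≤ filterHat φ₁ ψ₁ g 0 ξ := by
  rw [filterHat, if_pos rfl, fourier_liftFun_zero, norm_mul]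
  exact le_add_of_nonneg_right (tsum_nonneg fun j => filterTerm_nonneg _ _ _ _)

/-- A point of the horizontal cone outside the central square is moved into the cone piece: the
scale `j` is determined by `2^j / 2 < |ξ₁| < 2^j`, and the numerator `q` is the integer part of
`2^⌈j/2⌉ ξ₂ / ξ₁`. The points with `|ξ₁|` a power of two have to be left out, since the cone piece is
open. -/
lemma exists_shear_covering {ξ : Plane} (h1 : |ξ 1| ≤ |ξ 0|) (h0 : 1 / 2 < |ξ 0|)
    (hne : ∀ n : ℕ, 2 * |ξ 0| ≠ 2 ^ n) :
    ∃ (j : ℕ) (q : ℤ), |q| ≤ 2 ^ ((j + 1) / 2) ∧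
      !₂[ξ 0 / 2 ^ j, ξ 1 / 2 ^ (j / 2) - q * (ξ 0 / 2 ^ j)] ∈ coneSet := by
  obtain ⟨j, hj1, hj2⟩ := exists_nat_pow_near (show 1 ≤ 2 * |ξ 0| by linarith) one_lt_two
  have hj1' : (2 : ℝ) ^ j < 2 * |ξ 0| := lt_of_le_of_ne hj1 (hne j).symm
  have hx : ξ 0 ≠ 0 := by
    intro h
    rw [h] at h0
    norm_num at h0
  set k := (j + 1) / 2 with hk
  have hjk : (2 : ℝ) ^ j = 2 ^ k * 2 ^ (j / 2) := by
    rw [← pow_add]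
    congr 1
    omega
  set t : ℝ := ξ 1 / ξ 0 with ht
  have ht1 : |t| ≤ 1 := by
    rw [ht, abs_div]
    exact div_le_one_of_le₀ h1 (abs_nonneg _)
  have htk : |t * 2 ^ k| ≤ 2 ^ k := by
    rw [abs_mul, abs_of_pos (show (0 : ℝ) < 2 ^ k by positivity)]
    exact mul_le_of_le_one_left (by positivity) ht1
  refine ⟨j, ⌊t * 2 ^ k⌋, ?_, ?_, ?_, ?_⟩
  · rw [abs_le] at htk ⊢
    constructor
    · rw [Int.le_floor]
      push_cast
      exact htk.1
    · have : (⌊t * 2 ^ k⌋ : ℝ) ≤ ((2 ^ k : ℤ) : ℝ) := by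
        push_cast
        exact (Int.floor_le _).trans htk.2
      exact_mod_cast this
  · have e : (ξ 1 / 2 ^ (j / 2) - ⌊t * 2 ^ k⌋ * (ξ 0 / 2 ^ j)) / (ξ 0 / 2 ^ j) =
        Int.fract (t * 2 ^ k) := by
      rw [Int.fract, hjk, ht]
      field_simp
    simp only [Matrix.cons_val_zero, Matrix.cons_val_one]
    rw [e, abs_of_nonneg (Int.fract_nonneg _)]
    exact Int.fract_lt_one _
  · simp only [Matrix.cons_val_zero]
    rw [abs_div, abs_of_pos (show (0 : ℝ) < 2 ^ j by positivity), lt_div_iff₀ (by positivity)]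
    linarith
  · simp only [Matrix.cons_val_zero]
    rw [abs_div, abs_of_pos (show (0 : ℝ) < 2 ^ j by positivity), div_lt_one (by positivity)]
    rw [pow_succ] at hj2
    linarith

lemma exists_le_filterHat_of_horizontal {φ₁ ψ₁ : ℝ → ℂ} {g : Plane → ℂ}
    (hgen : IsGenerator φ₁ ψ₁ g) {δ : ℝ} (hδ : 0 < δ) (hg : ∀ ξ ∈ coneSet, δ ≤ ‖𝓕 g ξ‖)
    {ξ : Plane} (h1 : |ξ 1| ≤ |ξ 0|) (h0 : 1 / 2 < |ξ 0|) (hne : ∀ n : ℕ, 2 * |ξ 0| ≠ 2 ^ n) :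
    ∃ s : shearSet, δ ^ 2 ≤ filterHat φ₁ ψ₁ g s ξ := by
  obtain ⟨j, q, hq, hmem⟩ := exists_shear_covering h1 h0 hne
  refine ⟨⟨_, div_two_pow_mem_shearSet _ q hq⟩, ?_⟩
  refine le_trans ?_ (filterTerm_le_filterHat hgen _ (Nat.sInf_le ⟨q, rfl⟩) ξ)
  rw [filterTerm_div]
  have := hg _ hmem
  gcongr

lemma ae_two_mul_abs_ne (i : Fin 2) : ∀ᵐ ξ : Plane, ∀ n : ℕ, 2 * |ξ i| ≠ 2 ^ n := by
  have h : ∀ᵐ t : ℝ, ∀ n : ℕ, 2 * |t| ≠ 2 ^ n := by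
    rw [ae_all_iff]
    intro n
    have hsub : {t : ℝ | ¬ 2 * |t| ≠ 2 ^ n} ⊆ {2 ^ n / 2, -(2 ^ n / 2)} := by
      intro t ht
      have h1 : |t| = 2 ^ n / 2 := by
        have : 2 * |t| = 2 ^ n := not_not.1 ht
        linarith
      exact (abs_eq (by positivity)).1 h1
    exact measure_mono_null hsub ((Set.toFinite _).measure_zero _)
  have hq : Measure.QuasiMeasurePreserving (fun ξ : Plane => ξ i) volume volume := by
    fin_cases i
    · exact Measure.quasiMeasurePreserving_fst.comp
        measurePreserving_planeProd.quasiMeasurePreserving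
    · exact Measure.quasiMeasurePreserving_snd.comp
        measurePreserving_planeProd.quasiMeasurePreserving
  exact hq.ae h

lemma exists_filterSum_lower {φ₁ ψ₁ : ℝ → ℂ} {g : Plane → ℂ} (hgen : IsGenerator φ₁ ψ₁ g) :
    ∃ A : ℝ, 0 < A ∧ ∀ᵐ ξ : Plane, A ≤ filterSum φ₁ ψ₁ g ξ := by
  obtain ⟨δ, hδ, hφ⟩ := hgen.support_phi
  obtain ⟨ε, hε, hg⟩ := hgen.support_g
  obtain ⟨B, -, -, hB⟩ := exists_filter_bound hgen
  refine ⟨min (((δ * δ) ^ 2) ^ 2) ((ε ^ 2) ^ 2), by positivity, ?_⟩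
  filter_upwards [ae_two_mul_abs_ne 0, ae_two_mul_abs_ne 1] with ξ hξ0 hξ1
  have hle : ∀ s : shearSet, filterHat φ₁ ψ₁ g s ξ ^ 2 + filterHat φ₁ ψ₁ g s (rot ξ) ^ 2 ≤
      filterSum φ₁ ψ₁ g ξ := fun s =>
    (hB ξ).1.le_tsum s (fun s _ => by positivity)
  have r0 : rot ξ 0 = -ξ 1 := rfl
  have r1 : rot ξ 1 = ξ 0 := rfl
  by_cases hsmall : |ξ 0| ≤ 1 / 2 ∧ |ξ 1| ≤ 1 / 2
  · refine (min_le_left _ _).trans (le_trans ?_ (hle ⟨0, zero_mem_shearSet⟩))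
    have h1 := sq_le_filterHat_zero (φ₁ := φ₁) (ψ₁ := ψ₁) (g := g) ξ
    have h2 := hφ (ξ 0) (abs_le.1 hsmall.1)
    have h3 := hφ (ξ 1) (abs_le.1 hsmall.2)
    have h4 : (δ * δ) ^ 2 ≤ filterHat φ₁ ψ₁ g 0 ξ := le_trans (by gcongr) h1
    refine le_add_of_le_of_nonneg ?_ (sq_nonneg _)
    exact pow_le_pow_left₀ (by positivity) h4 2
  · refine (min_le_right _ _).trans ?_
    rcases le_total |ξ 1| |ξ 0| with h | h
    · have h0 : 1 / 2 < |ξ 0| := by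
        by_contra! hc
        exact hsmall ⟨hc, h.trans hc⟩
      obtain ⟨s, hs⟩ := exists_le_filterHat_of_horizontal hgen hε hg h h0 hξ0
      refine le_trans ?_ (hle s)
      exact le_add_of_le_of_nonneg (pow_le_pow_left₀ (by positivity) hs 2) (sq_nonneg _)
    · have h0 : 1 / 2 < |ξ 1| := by
        by_contra! hc
        exact hsmall ⟨h.trans hc, hc⟩
      obtain ⟨s, hs⟩ := exists_le_filterHat_of_horizontal hgen hε hg (ξ := rot ξ)
        (by rwa [r0, r1, abs_neg]) (by rwa [r0, abs_neg]) (by simpa only [r0, abs_neg] using hξ1)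
      refine le_trans ?_ (hle s)
      exact le_add_of_nonneg_of_le (sq_nonneg _) (pow_le_pow_left₀ (by positivity) hs 2)

lemma filtersConverge {φ₁ ψ₁ : ℝ → ℂ} {g : Plane → ℂ} (hgen : IsGenerator φ₁ ψ₁ g) :
    FiltersConverge φ₁ ψ₁ g := by
  obtain ⟨B, -, -, hB⟩ := exists_filter_bound hgen
  obtain ⟨A, hA, hAD⟩ := exists_filterSum_lower hgen
  obtain ⟨ξ₀, hξ₀⟩ := hAD.exists
  refine ⟨A, B ^ 2 + B ^ 2, hA, hξ₀.trans (hB ξ₀).2, ?_⟩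
  filter_upwards [hAD] with ξ hξ
  exact ⟨fun s => summable_filterTerm hgen s ξ, (hB ξ).1, hξ, (hB ξ).2⟩

/-! ### Frames in Hilbert spaces -/

section Frames

variable {H ι : Type*} [NormedAddCommGroup H] [InnerProductSpace ℂ H] {e : ι → H}

lemma summable_sq_of_tsum_enorm_ne_top {a : ι → ℂ} (h : ∑' i, ‖a i‖ₑ ^ 2 ≠ ∞) :
    Summable fun i => ‖a i‖ ^ 2 := by
  simpa using ENNReal.summable_toReal h

lemma ofReal_tsum_sq {a : ι → ℂ} (h : Summable fun i => ‖a i‖ ^ 2) :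
    ENNReal.ofReal (∑' i, ‖a i‖ ^ 2) = ∑' i, ‖a i‖ₑ ^ 2 :=
  (tsum_enorm_sq_of_hasSum h.hasSum).symm

lemma isFrame_of_tsum_enorm {A B : ℝ} (hA : 0 < A) (hAB : A ≤ B)
    (h1 : ∀ f : H, ENNReal.ofReal A * ‖f‖ₑ ^ 2 ≤ ∑' i, ‖inner ℂ (e i) f‖ₑ ^ 2)
    (h2 : ∀ f : H, ∑' i, ‖inner ℂ (e i) f‖ₑ ^ 2 ≤ ENNReal.ofReal B * ‖f‖ₑ ^ 2) : IsFrame e := by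
  refine ⟨A, B, hA, hAB, fun f => ?_⟩
  have hB : 0 ≤ B := hA.le.trans hAB
  have key : ∀ {c : ℝ}, 0 ≤ c → ENNReal.ofReal c * ‖f‖ₑ ^ 2 = ENNReal.ofReal (c * ‖f‖ ^ 2) :=
    fun hc => by rw [ENNReal.ofReal_mul hc, ENNReal.ofReal_pow (norm_nonneg _), ofReal_norm]
  have h1f := h1 f
  have h2f := h2 f
  rw [key hA.le] at h1f
  rw [key hB] at h2f
  have hs := summable_sq_of_tsum_enorm_ne_top (ne_top_of_le_ne_top ENNReal.ofReal_ne_top h2f)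
  rw [← ofReal_tsum_sq hs] at h1f h2f
  refine ⟨hs, ?_, ?_⟩
  · exact (ENNReal.ofReal_le_ofReal_iff (tsum_nonneg fun i => by positivity)).1 h1f
  · exact (ENNReal.ofReal_le_ofReal_iff (by positivity)).1 h2f

lemma hasSum_sq_of_tsum_enorm {V : Type*} [NormedAddCommGroup V] {a : ι → ℂ} {x : V} (h : ∑' i, ‖a i‖ₑ ^ 2 = ‖x‖ₑ ^ 2) :
    HasSum (fun i => ‖a i‖ ^ 2) (‖x‖ ^ 2) := by
  have hs : Summable fun i => ‖a i‖ ^ 2 :=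
    summable_sq_of_tsum_enorm_ne_top (by rw [h]; exact ENNReal.pow_ne_top enorm_ne_top)
  have h2 := ofReal_tsum_sq hs
  rw [h, ← ofReal_norm, ← ENNReal.ofReal_pow (norm_nonneg _),
    ENNReal.ofReal_eq_ofReal_iff (tsum_nonneg fun i => by positivity) (by positivity)] at h2
  rw [← h2]
  exact hs.hasSum

/-- Boundedness of the synthesis operator on finite sums. -/
lemma IsFrame.exists_norm_sum_sq_le (he : IsFrame e) :
    ∃ B : ℝ, 0 < B ∧ ∀ (c : ι → ℂ) (t : Finset ι),
      ‖∑ i ∈ t, c i • e i‖ ^ 2 ≤ B * ∑ i ∈ t, ‖c i‖ ^ 2 := by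
  obtain ⟨A, B, hA, hAB, hf⟩ := he
  refine ⟨B, hA.trans_le hAB, fun c t => ?_⟩
  set v := ∑ i ∈ t, c i • e i with hv
  have h1 : ‖v‖ ^ 2 ≤ ∑ i ∈ t, ‖c i‖ * ‖inner ℂ (e i) v‖ := by
    have : ((‖v‖ ^ 2 : ℝ) : ℂ) = ∑ i ∈ t, conj (c i) * inner ℂ (e i) v := by
      have h := inner_self_eq_norm_sq_to_K (𝕜 := ℂ) v
      nth_rw 1 [hv] at h
      rw [sum_inner] at h
      simp_rw [inner_smul_left] at h
      rw [h]
      norm_cast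
    calc ‖v‖ ^ 2 = ‖((‖v‖ ^ 2 : ℝ) : ℂ)‖ := by
          rw [Complex.norm_real, Real.norm_of_nonneg (by positivity)]
      _ ≤ ∑ i ∈ t, ‖conj (c i) * inner ℂ (e i) v‖ := by rw [this]; exact norm_sum_le _ _
      _ = _ := by simp
  have h2 : (∑ i ∈ t, ‖c i‖ * ‖inner ℂ (e i) v‖) ^ 2 ≤
      (∑ i ∈ t, ‖c i‖ ^ 2) * (B * ‖v‖ ^ 2) := by
    refine (Finset.sum_mul_sq_le_sq_mul_sq _ _ _).trans ?_
    gcongr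
    exact ((hf v).1.sum_le_tsum t fun i _ => by positivity).trans (hf v).2.2
  have h3 : (‖v‖ ^ 2) ^ 2 ≤ (∑ i ∈ t, ‖c i‖ ^ 2) * (B * ‖v‖ ^ 2) :=
    (pow_le_pow_left₀ (by positivity) h1 2).trans h2
  rcases (sq_nonneg ‖v‖).eq_or_lt with h0 | h0
  · rw [← h0]
    exact mul_nonneg (hA.le.trans hAB) (Finset.sum_nonneg fun i _ => by positivity)
  · refine le_of_mul_le_mul_right ?_ h0
    linarith

lemma IsFrame.summable_smul [CompleteSpace H] (he : IsFrame e) {c : ι → ℂ}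
    (hc : Summable fun i => ‖c i‖ ^ 2) : Summable fun i => c i • e i := by
  obtain ⟨B, hB, hle⟩ := he.exists_norm_sum_sq_le
  rw [summable_iff_vanishing_norm] at hc ⊢
  intro ε hε
  obtain ⟨s, hs⟩ := hc (ε ^ 2 / B) (by positivity)
  refine ⟨s, fun t ht => ?_⟩
  have h1 := hs t ht
  rw [Real.norm_of_nonneg (Finset.sum_nonneg fun i _ => by positivity), lt_div_iff₀ hB] at h1
  refine lt_of_pow_lt_pow_left₀ 2 hε.le ((hle c t).trans_lt ?_)
  linarith

/-- The frame operator is determined by its quadratic form `∑ |⟨f, e i⟩|²`. -/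
lemma IsFrame.hasSum_of_inner_eq [CompleteSpace H] (he : IsFrame e) (P : H →ₗ[ℂ] H)
    (hP : ∀ f, HasSum (fun i => ((‖inner ℂ (e i) f‖ ^ 2 : ℝ) : ℂ)) (inner ℂ (P f) f)) (f : H) :
    HasSum (fun i => inner ℂ (e i) f • e i) (P f) := by
  have hs : ∀ f, Summable fun i => inner ℂ (e i) f • e i := fun f =>
    he.summable_smul (he.choose_spec.choose_spec.2.2 f).1
  let T : H →ₗ[ℂ] H :=
    { toFun := fun f => ∑' i, inner ℂ (e i) f • e i
      map_add' := fun f g => by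
        simp_rw [inner_add_right, add_smul]
        exact (hs f).tsum_add (hs g)
      map_smul' := fun c f => by
        simp_rw [inner_smul_right, mul_smul]
        exact (hs f).tsum_const_smul c }
  have hT : T = P := by
    refine (ext_inner_map T P).1 fun f => ?_
    refine HasSum.unique ?_ (hP f)
    have h := (hs f).hasSum.mapL ((innerSL ℂ f))
    have h2 := (RCLike.hasSum_conj' ℂ).2 h
    have hterm : ∀ i, conj (inner ℂ f (inner ℂ (e i) f • e i)) =
        ((‖inner ℂ (e i) f‖ ^ 2 : ℝ) : ℂ) := fun i => by
      rw [inner_conj_symm, inner_smul_left, RCLike.conj_mul]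
      norm_cast
    simp only [innerSL_apply_apply, hterm] at h2
    rw [inner_conj_symm] at h2
    exact h2
  have h := (hs f).hasSum
  have h' : ∑' i, inner ℂ (e i) f • e i = P f := by rw [← hT]; rfl
  rwa [h'] at h

end Frames

/-! ### Filtered wavelet systems and their frame bounds -/

/-- The system of all `M_s`-filtered elements of the wavelet systems, together with their rotations.
The shearlet system has `M_s = Ĝ_s`, its dual system `M_s = Ĝ_s / 𝒟`. -/
def filteredSystem (φ₁ ψ₁ : ℝ → ℂ) (M : ℝ → Plane → ℝ) (i : Idx) : L2Plane :=
  if i.1 = 0 then fourierMul (M i.2.1) (toL2 (waveletElt φ₁ ψ₁ i.2.1 i.2.2))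
  else rotL2 (fourierMul (M i.2.1) (toL2 (waveletElt φ₁ ψ₁ i.2.1 i.2.2)))

lemma shearletSystem_eq (φ₁ ψ₁ : ℝ → ℂ) (g : Plane → ℂ) :
    shearletSystem φ₁ ψ₁ g = filteredSystem φ₁ ψ₁ (filterHat φ₁ ψ₁ g) := rfl

lemma dualSystem_eq (φ₁ ψ₁ : ℝ → ℂ) (g : Plane → ℂ) :
    dualSystem φ₁ ψ₁ g = filteredSystem φ₁ ψ₁
      (fun s ξ => filterHat φ₁ ψ₁ g s ξ / filterSum φ₁ ψ₁ g ξ) := rfl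

lemma tsum_enorm_inner_waveletElt {φ₁ ψ₁ : ℝ → ℂ} (h : IsONBFun (waveletFun φ₁ ψ₁)) (s : ℝ)
    (f : L2Plane) : ∑' l, ‖inner ℂ (toL2 (waveletElt φ₁ ψ₁ s l)) f‖ₑ ^ 2 = ‖f‖ₑ ^ 2 := by
  have hP := isParseval_waveletElt h s
  rw [← lintegral_enorm_sq_lp, ← hP.2 f (Lp.memLp f)]
  refine tsum_congr fun l => ?_
  rw [inner_toLp_eq (toL2_coe (hP.1 l)) (Filter.EventuallyEq.refl _ _)]

lemma tsum_enorm_inner_filteredSystem {φ₁ ψ₁ : ℝ → ℂ} (h : IsONBFun (waveletFun φ₁ ψ₁))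
    {M : ℝ → Plane → ℝ} (hM : ∀ s : shearSet, IsMultiplier (M s)) (f : L2Plane) :
    ∑' i, ‖inner ℂ (filteredSystem φ₁ ψ₁ M i) f‖ₑ ^ 2 =
      ∫⁻ ξ, (∑' s : shearSet, ENNReal.ofReal (M s ξ ^ 2 + M s (rot ξ) ^ 2)) *
        ‖(𝓕 f : L2Plane) ξ‖ₑ ^ 2 := by
  -- writing `f` as a rotation turns the coefficients with the rotated elements into coefficients
  -- of `f'` with the unrotated ones
  obtain ⟨f', rfl⟩ := rotL2_surjective f
  have hfm : ∀ u : L2Plane, AEMeasurable (fun ξ => ‖(𝓕 u : L2Plane) ξ‖ₑ ^ 2) volume := fun u =>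
    (Lp.memLp (𝓕 u : L2Plane)).1.enorm.pow_const 2
  have hMm : ∀ s : shearSet, AEMeasurable (fun ξ => ENNReal.ofReal (M s ξ ^ 2)) volume := fun s =>
    ((hM s).1.aemeasurable.pow_const 2).ennreal_ofReal
  have hMr : ∀ s : shearSet, AEMeasurable (fun ξ => ENNReal.ofReal (M s (rot ξ) ^ 2)) volume :=
    fun s => (hMm s).comp_quasiMeasurePreserving rot.measurePreserving.quasiMeasurePreserving
  have h0 : ∀ s : shearSet,
      ∑' l : Lam (s : ℝ), ‖inner ℂ (filteredSystem φ₁ ψ₁ M (0, ⟨s, l⟩)) (rotL2 f')‖ₑ ^ 2 =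
        ∫⁻ ξ, ENNReal.ofReal (M s ξ ^ 2) * ‖(𝓕 (rotL2 f') : L2Plane) ξ‖ₑ ^ 2 := by
    intro s
    rw [← enorm_fourierMul (hM s), ← tsum_enorm_inner_waveletElt h s]
    refine tsum_congr fun l => ?_
    rw [← inner_fourierMul_left (hM s)]
    rfl
  have h1 : ∀ s : shearSet,
      ∑' l : Lam (s : ℝ), ‖inner ℂ (filteredSystem φ₁ ψ₁ M (1, ⟨s, l⟩)) (rotL2 f')‖ₑ ^ 2 =
        ∫⁻ ξ, ENNReal.ofReal (M s (rot ξ) ^ 2) * ‖(𝓕 (rotL2 f') : L2Plane) ξ‖ₑ ^ 2 := by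
    intro s
    have e : ∫⁻ ξ, ENNReal.ofReal (M s (rot ξ) ^ 2) * ‖(𝓕 (rotL2 f') : L2Plane) ξ‖ₑ ^ 2 =
        ‖fourierMul (M s) f'‖ₑ ^ 2 := by
      rw [enorm_fourierMul (hM s), fourier_rotL2,
        ← rot.measurePreserving.lintegral_comp_emb rot.toHomeomorph.measurableEmbedding
          (fun ξ => ENNReal.ofReal (M s ξ ^ 2) * ‖(𝓕 f' : L2Plane) ξ‖ₑ ^ 2)]
      refine lintegral_congr_ae ?_
      filter_upwards [rotL2_coe (𝓕 f')] with ξ hξ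
      rw [hξ]
    rw [e, ← tsum_enorm_inner_waveletElt h s]
    refine tsum_congr fun l => ?_
    rw [← inner_fourierMul_left (hM s)]
    exact congrArg (fun z : ℂ => ‖z‖ₑ ^ 2) (inner_rotL2 _ _)
  rw [ENNReal.tsum_prod', tsum_fintype, Fin.sum_univ_two, ENNReal.tsum_sigma', ENNReal.tsum_sigma',
    ← ENNReal.tsum_add]
  simp_rw [h0, h1, ← ENNReal.tsum_mul_right]
  rw [lintegral_tsum]
  · refine tsum_congr fun s => ?_
    refine (lintegral_add_left' ((hMm s).mul (hfm (rotL2 f'))) (fun ξ =>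
      ENNReal.ofReal (M s (rot ξ) ^ 2) * ‖(𝓕 (rotL2 f') : L2Plane) ξ‖ₑ ^ 2)).symm.trans ?_
    refine lintegral_congr fun ξ => ?_
    rw [ENNReal.ofReal_add (sq_nonneg _) (sq_nonneg _), add_mul, Pi.mul_apply]
  · intro s
    refine AEMeasurable.mul ?_ (hfm _)
    simp_rw [ENNReal.ofReal_add (sq_nonneg _) (sq_nonneg _)]
    exact (hMm s).add (hMr s)

lemma isFrame_filteredSystem {φ₁ ψ₁ : ℝ → ℂ} (h : IsONBFun (waveletFun φ₁ ψ₁))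
    {M : ℝ → Plane → ℝ} (hM : ∀ s : shearSet, IsMultiplier (M s)) {A B : ℝ} (hA : 0 < A)
    (hsum : ∀ᵐ ξ, Summable (fun s : shearSet => M s ξ ^ 2 + M s (rot ξ) ^ 2))
    (hle : ∀ᵐ ξ, A ≤ ∑' s : shearSet, (M s ξ ^ 2 + M s (rot ξ) ^ 2))
    (hge : ∀ᵐ ξ, ∑' s : shearSet, (M s ξ ^ 2 + M s (rot ξ) ^ 2) ≤ B) :
    IsFrame (filteredSystem φ₁ ψ₁ M) := by
  obtain ⟨ξ₀, h1, h2⟩ := (hle.and hge).exists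
  have hnorm : ∀ (c : ℝ) (f : L2Plane), ENNReal.ofReal c * ‖f‖ₑ ^ 2 =
      ∫⁻ ξ, ENNReal.ofReal c * ‖(𝓕 f : L2Plane) ξ‖ₑ ^ 2 := by
    intro c f
    rw [lintegral_const_mul' _ _ ENNReal.ofReal_ne_top, lintegral_enorm_sq_lp, ← ofReal_norm,
      ← ofReal_norm, Lp.norm_fourier_eq]
  refine isFrame_of_tsum_enorm hA (h1.trans h2) (fun f => ?_) (fun f => ?_)
  · rw [tsum_enorm_inner_filteredSystem h hM, hnorm]
    refine lintegral_mono_ae ?_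
    filter_upwards [hsum, hle] with ξ hs hl
    rw [← ENNReal.ofReal_tsum_of_nonneg (fun s => by positivity) hs]
    gcongr
  · rw [tsum_enorm_inner_filteredSystem h hM, hnorm]
    refine lintegral_mono_ae ?_
    filter_upwards [hsum, hge] with ξ hs hl
    rw [← ENNReal.ofReal_tsum_of_nonneg (fun s => by positivity) hs]
    gcongr

lemma isMultiplier_filterHat {φ₁ ψ₁ : ℝ → ℂ} {g : Plane → ℂ} (hgen : IsGenerator φ₁ ψ₁ g)
    (s : shearSet) : IsMultiplier (filterHat φ₁ ψ₁ g s) := by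
  obtain ⟨B, -, hB, -⟩ := exists_filter_bound hgen
  refine ⟨(measurable_filterHat hgen s).aestronglyMeasurable, B,
    Filter.Eventually.of_forall fun ξ => ?_⟩
  rw [Real.norm_of_nonneg (filterHat_nonneg _ _ _ _ _)]
  exact hB s ξ

lemma isMultiplier_filterSum_inv {φ₁ ψ₁ : ℝ → ℂ} {g : Plane → ℂ} (hgen : IsGenerator φ₁ ψ₁ g) :
    IsMultiplier (fun ξ => (filterSum φ₁ ψ₁ g ξ)⁻¹) := by
  obtain ⟨A, hA, hAD⟩ := exists_filterSum_lower hgen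
  refine ⟨(measurable_filterSum hgen).inv.aestronglyMeasurable, A⁻¹, ?_⟩
  filter_upwards [hAD] with ξ hξ
  rw [norm_inv, Real.norm_of_nonneg (hA.le.trans hξ)]
  gcongr

lemma IsMultiplier.mul {m m' : Plane → ℝ} (hm : IsMultiplier m) (hm' : IsMultiplier m') :
    IsMultiplier (fun ξ => m ξ * m' ξ) := by
  obtain ⟨h1, C, hC⟩ := hm
  obtain ⟨h1', C', hC'⟩ := hm'
  refine ⟨h1.mul h1', C * C', ?_⟩
  filter_upwards [hC, hC'] with ξ a b
  rw [norm_mul]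
  have := (norm_nonneg _).trans a
  gcongr

lemma fourierMul_fourierMul {m m' n : Plane → ℝ} (hm : IsMultiplier m) (hm' : IsMultiplier m')
    (hn : IsMultiplier n) (h : ∀ᵐ ξ, m ξ * m' ξ = n ξ) (f : L2Plane) :
    fourierMul m (fourierMul m' f) = fourierMul n f := by
  apply ext_fourier
  filter_upwards [fourier_fourierMul hm (fourierMul m' f), fourier_fourierMul hm' f,
    fourier_fourierMul hn f, h] with ξ a b c d
  rw [a, b, c, ← d]
  push_cast
  ring

lemma isMultiplier_dual {φ₁ ψ₁ : ℝ → ℂ} {g : Plane → ℂ} (hgen : IsGenerator φ₁ ψ₁ g)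
    (s : shearSet) : IsMultiplier (fun ξ => filterHat φ₁ ψ₁ g s ξ / filterSum φ₁ ψ₁ g ξ) :=
  (isMultiplier_filterHat hgen s).mul (isMultiplier_filterSum_inv hgen)

lemma fourierFormulas {φ₁ ψ₁ : ℝ → ℂ} {g : Plane → ℂ} (hgen : IsGenerator φ₁ ψ₁ g) :
    FourierFormulas φ₁ ψ₁ g := by
  intro s l
  refine ⟨(isParseval_waveletElt hgen.onb s).1 l,
    fourier_fourierMul (isMultiplier_filterHat hgen s) _, ?_⟩
  filter_upwards [fourier_fourierMul (isMultiplier_dual hgen s) (toL2 (waveletElt φ₁ ψ₁ s l)),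
    fourier_fourierMul (isMultiplier_filterHat hgen s) (toL2 (waveletElt φ₁ ψ₁ s l))] with ξ a b
  rw [dual0, a, shearlet0, b]
  push_cast
  ring

lemma isFrame_shearletSystem {φ₁ ψ₁ : ℝ → ℂ} {g : Plane → ℂ} (hgen : IsGenerator φ₁ ψ₁ g) :
    IsFrame (shearletSystem φ₁ ψ₁ g) := by
  obtain ⟨A, B, hA, hAB, hall⟩ := filtersConverge hgen
  rw [shearletSystem_eq]
  exact isFrame_filteredSystem hgen.onb (isMultiplier_filterHat hgen) hA
    (hall.mono fun ξ h => h.2.1) (hall.mono fun ξ h => h.2.2.1) (hall.mono fun ξ h => h.2.2.2)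

/-- For complex generators the denominator need not be invariant under the rotation, so it is
bounded separately at `ξ` and at the rotated point. -/
lemma isFrame_dualSystem {φ₁ ψ₁ : ℝ → ℂ} {g : Plane → ℂ} (hgen : IsGenerator φ₁ ψ₁ g) :
    IsFrame (dualSystem φ₁ ψ₁ g) := by
  obtain ⟨A, B, hA, hAB, hall⟩ := filtersConverge hgen
  have hB := hA.trans_le hAB
  have hrot := rot.measurePreserving.quasiMeasurePreserving.ae hall
  rw [dualSystem_eq]
  have hterm : ∀ {x D : ℝ}, A ≤ D → D ≤ B →
      x ^ 2 / B ^ 2 ≤ (x / D) ^ 2 ∧ (x / D) ^ 2 ≤ x ^ 2 / A ^ 2 := by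
    intro x D h1 h2
    have hD := hA.trans_le h1
    rw [div_pow]
    constructor <;> gcongr
  have hlo : ∀ᵐ ξ, ∀ s : shearSet,
      (filterHat φ₁ ψ₁ g s ξ ^ 2 + filterHat φ₁ ψ₁ g s (rot ξ) ^ 2) / B ^ 2 ≤
        (filterHat φ₁ ψ₁ g s ξ / filterSum φ₁ ψ₁ g ξ) ^ 2 +
          (filterHat φ₁ ψ₁ g s (rot ξ) / filterSum φ₁ ψ₁ g (rot ξ)) ^ 2 := by
    filter_upwards [hall, hrot] with ξ h h' s
    rw [add_div]
    exact add_le_add (hterm h.2.2.1 h.2.2.2).1 (hterm h'.2.2.1 h'.2.2.2).1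
  have hhi : ∀ᵐ ξ, ∀ s : shearSet,
      (filterHat φ₁ ψ₁ g s ξ / filterSum φ₁ ψ₁ g ξ) ^ 2 +
          (filterHat φ₁ ψ₁ g s (rot ξ) / filterSum φ₁ ψ₁ g (rot ξ)) ^ 2 ≤
        (filterHat φ₁ ψ₁ g s ξ ^ 2 + filterHat φ₁ ψ₁ g s (rot ξ) ^ 2) / A ^ 2 := by
    filter_upwards [hall, hrot] with ξ h h' s
    rw [add_div]
    exact add_le_add (hterm h.2.2.1 h.2.2.2).2 (hterm h'.2.2.1 h'.2.2.2).2
  have hsum : ∀ᵐ ξ, Summable fun s : shearSet =>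
      (filterHat φ₁ ψ₁ g s ξ / filterSum φ₁ ψ₁ g ξ) ^ 2 +
          (filterHat φ₁ ψ₁ g s (rot ξ) / filterSum φ₁ ψ₁ g (rot ξ)) ^ 2 := by
    filter_upwards [hall, hhi] with ξ h hξ
    exact (h.2.1.div_const _).of_nonneg_of_le (fun s => by positivity) hξ
  refine isFrame_filteredSystem hgen.onb (isMultiplier_dual hgen) (A := A / B ^ 2)
    (B := B / A ^ 2) (by positivity) hsum ?_ ?_
  · filter_upwards [hall, hlo, hsum] with ξ h hξ hs
    calc A / B ^ 2 ≤ filterSum φ₁ ψ₁ g ξ / B ^ 2 := by gcongr; exact h.2.2.1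
      _ = ∑' s : shearSet,
          (filterHat φ₁ ψ₁ g s ξ ^ 2 + filterHat φ₁ ψ₁ g s (rot ξ) ^ 2) / B ^ 2 := by
        rw [filterSum, tsum_div_const]
      _ ≤ _ := (h.2.1.div_const _).tsum_le_tsum hξ hs
  · filter_upwards [hall, hhi, hsum] with ξ h hξ hs
    calc _ ≤ ∑' s : shearSet,
          (filterHat φ₁ ψ₁ g s ξ ^ 2 + filterHat φ₁ ψ₁ g s (rot ξ) ^ 2) / A ^ 2 :=
          hs.tsum_le_tsum hξ (h.2.1.div_const _)
      _ = filterSum φ₁ ψ₁ g ξ / A ^ 2 := by rw [filterSum, tsum_div_const]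
      _ ≤ B / A ^ 2 := by gcongr; exact h.2.2.2

/-! ### Real generators and the reconstruction formula -/

lemma norm_fourier_neg_of_real {E : Type*} [NormedAddCommGroup E]
    [InnerProductSpace ℝ E] [FiniteDimensional ℝ E] [MeasurableSpace E] [BorelSpace E]
    {f : E → ℂ} (hf : ∀ᵐ x, (f x).im = 0) (ξ : E) : ‖𝓕 f (-ξ)‖ = ‖𝓕 f ξ‖ := by
  have : 𝓕 f (-ξ) = conj (𝓕 f ξ) := by
    rw [Real.fourier_eq', Real.fourier_eq', ← integral_conj]
    refine integral_congr_ae ?_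
    filter_upwards [hf] with x hx
    rw [smul_eq_mul, smul_eq_mul, map_mul, Complex.conj_eq_iff_im.2 hx, ← Complex.exp_conj]
    have h2 : conj (2 : ℂ) = 2 := map_ofNat _ 2
    simp [h2]
  rw [this, RCLike.norm_conj]

lemma filterHat_neg {φ₁ ψ₁ : ℝ → ℂ} {g : Plane → ℂ} (hφ : ∀ᵐ x, (φ₁ x).im = 0)
    (hg : ∀ᵐ x, (g x).im = 0) (s : ℝ) (ξ : Plane) :
    filterHat φ₁ ψ₁ g s (-ξ) = filterHat φ₁ ψ₁ g s ξ := by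
  have h1 : ‖𝓕 (liftFun φ₁ ψ₁ φ₁ 0) (-ξ)‖ = ‖𝓕 (liftFun φ₁ ψ₁ φ₁ 0) ξ‖ := by
    rw [fourier_liftFun_zero, fourier_liftFun_zero, norm_mul, norm_mul, PiLp.neg_apply,
      PiLp.neg_apply, norm_fourier_neg_of_real hφ, norm_fourier_neg_of_real hφ]
  have h2 : ∀ j, filterTerm g s j (-ξ) = filterTerm g s j ξ := by
    intro j
    rw [filterTerm, filterTerm, act, act, map_neg, norm_fourier_neg_of_real hg]
  simp_rw [filterHat, h1, h2]

lemma filterSum_rot {φ₁ ψ₁ : ℝ → ℂ} {g : Plane → ℂ} (hφ : ∀ᵐ x, (φ₁ x).im = 0)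
    (hg : ∀ᵐ x, (g x).im = 0) (ξ : Plane) :
    filterSum φ₁ ψ₁ g (rot ξ) = filterSum φ₁ ψ₁ g ξ := by
  have h : rot (rot ξ) = -ξ := by
    ext i
    fin_cases i <;> simp [rot]
  refine tsum_congr fun s => ?_
  rw [h, filterHat_neg hφ hg, add_comm]

/-- The frame operator of the shearlet system is the Fourier multiplier with the denominator. -/
lemma hasSum_frameOperator {φ₁ ψ₁ : ℝ → ℂ} {g : Plane → ℂ} (hgen : IsGenerator φ₁ ψ₁ g)
    (f : L2Plane) : HasSum (fun i => inner ℂ (shearletSystem φ₁ ψ₁ g i) f • shearletSystem φ₁ ψ₁ g i)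
      (fourierMul (filterSum φ₁ ψ₁ g) f) := by
  obtain ⟨B, -, -, hB⟩ := exists_filter_bound hgen
  have h0 : ∀ ξ, 0 ≤ filterSum φ₁ ψ₁ g ξ := fun ξ => tsum_nonneg fun s => by positivity
  have hm := measurable_filterSum hgen
  have hD : IsMultiplier (filterSum φ₁ ψ₁ g) :=
    ⟨hm.aestronglyMeasurable, B ^ 2 + B ^ 2, Filter.Eventually.of_forall fun ξ => by
      rw [Real.norm_of_nonneg (h0 ξ)]; exact (hB ξ).2⟩
  have hR : IsMultiplier (fun ξ => √(filterSum φ₁ ψ₁ g ξ)) :=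
    ⟨hm.sqrt.aestronglyMeasurable, √(B ^ 2 + B ^ 2), Filter.Eventually.of_forall fun ξ => by
      rw [Real.norm_of_nonneg (Real.sqrt_nonneg _)]; exact Real.sqrt_le_sqrt (hB ξ).2⟩
  -- the square root of the denominator expresses the quadratic form as a squared norm
  refine (isFrame_shearletSystem hgen).hasSum_of_inner_eq (fourierMulCLM hD).toLinearMap
    (fun f => ?_) f
  change HasSum _ (inner ℂ (fourierMul (filterSum φ₁ ψ₁ g) f) f)
  rw [← fourierMul_fourierMul hR hR hD (Filter.Eventually.of_forall fun ξ => Real.mul_self_sqrt (h0 ξ)),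
    inner_fourierMul_left hR, inner_self_eq_norm_sq_to_K]
  have key : ∑' i, ‖inner ℂ (shearletSystem φ₁ ψ₁ g i) f‖ₑ ^ 2 =
      ‖fourierMul (fun ξ => √(filterSum φ₁ ψ₁ g ξ)) f‖ₑ ^ 2 := by
    rw [enorm_fourierMul hR, shearletSystem_eq,
      tsum_enorm_inner_filteredSystem hgen.onb (isMultiplier_filterHat hgen)]
    refine lintegral_congr fun ξ => ?_
    rw [Real.sq_sqrt (h0 ξ), filterSum,
      ENNReal.ofReal_tsum_of_nonneg (fun s => by positivity) (hB ξ).1]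
  have hs := (hasSum_sq_of_tsum_enorm key).mapL Complex.ofRealCLM
  rw [Complex.ofRealCLM_apply, Complex.ofReal_pow] at hs
  exact hs

lemma dualSystem_eq_fourierMul {φ₁ ψ₁ : ℝ → ℂ} {g : Plane → ℂ} (hgen : IsGenerator φ₁ ψ₁ g)
    (hφ : ∀ᵐ x, (φ₁ x).im = 0) (hg : ∀ᵐ x, (g x).im = 0) (i : Idx) :
    dualSystem φ₁ ψ₁ g i =
      fourierMul (fun ξ => (filterSum φ₁ ψ₁ g ξ)⁻¹) (shearletSystem φ₁ ψ₁ g i) := by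
  have hI := isMultiplier_filterSum_inv hgen
  have h : dual0 φ₁ ψ₁ g i.2.1 i.2.2 =
      fourierMul (fun ξ => (filterSum φ₁ ψ₁ g ξ)⁻¹) (shearlet0 φ₁ ψ₁ g i.2.1 i.2.2) :=
    (fourierMul_fourierMul hI (isMultiplier_filterHat hgen i.2.1) (isMultiplier_dual hgen i.2.1)
      (Filter.Eventually.of_forall fun ξ => inv_mul_eq_div _ _) _).symm
  rw [dualSystem, shearletSystem, h]
  split_ifs
  · rfl
  · exact rotL2_fourierMul hI hI (fun ξ => by rw [filterSum_rot hφ hg]) _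

lemma reconstructs {φ₁ ψ₁ : ℝ → ℂ} {g : Plane → ℂ} (hgen : IsGenerator φ₁ ψ₁ g)
    (hφ : ∀ᵐ x, (φ₁ x).im = 0) (hg : ∀ᵐ x, (g x).im = 0) :
    Reconstructs (shearletSystem φ₁ ψ₁ g) (dualSystem φ₁ ψ₁ g) := by
  intro f
  obtain ⟨A, B, hA, hAB, hall⟩ := filtersConverge hgen
  have hI := isMultiplier_filterSum_inv hgen
  have hD : IsMultiplier (filterSum φ₁ ψ₁ g) :=
    ⟨(measurable_filterSum hgen).aestronglyMeasurable, B, hall.mono fun ξ h => by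
      rw [Real.norm_of_nonneg (hA.le.trans h.2.2.1)]; exact h.2.2.2⟩
  have hone : IsMultiplier (fun _ => 1) := ⟨aestronglyMeasurable_const, 1, by simp⟩
  have hf : fourierMul (fun ξ => (filterSum φ₁ ψ₁ g ξ)⁻¹) (fourierMul (filterSum φ₁ ψ₁ g) f) = f := by
    rw [fourierMul_fourierMul hI hD hone (hall.mono fun ξ h =>
      inv_mul_cancel₀ (hA.trans_le h.2.2.1).ne')]
    apply ext_fourier
    filter_upwards [fourier_fourierMul hone f] with ξ h
    simpa using h
  have h := (hasSum_frameOperator hgen f).mapL (fourierMulCLM hI)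
  simp_rw [map_smul] at h
  change HasSum (fun i => _ • fourierMul (fun ξ => (filterSum φ₁ ψ₁ g ξ)⁻¹) _)
    (fourierMul (fun ξ => (filterSum φ₁ ψ₁ g ξ)⁻¹) _) at h
  rw [hf] at h
  simpa only [dualSystem_eq_fourierMul hgen hφ hg] using h

end DualizableShearlet

end

open DualizableShearlet in
theorem theorem3p1 (φ₁ ψ₁ : ℝ → ℂ) (g : Plane → ℂ) (hgen : IsGenerator φ₁ ψ₁ g) :
    FiltersConverge φ₁ ψ₁ g ∧
    FourierFormulas φ₁ ψ₁ g ∧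
    IsFrame (shearletSystem φ₁ ψ₁ g) ∧
    IsFrame (dualSystem φ₁ ψ₁ g) ∧
    ((∀ᵐ x, (φ₁ x).im = 0) → (∀ᵐ x, (g x).im = 0) →
      IsDualFrame (shearletSystem φ₁ ψ₁ g) (dualSystem φ₁ ψ₁ g)) :=
  ⟨filtersConverge hgen, fourierFormulas hgen, isFrame_shearletSystem hgen,
    isFrame_dualSystem hgen, fun hφ hg => ⟨isFrame_shearletSystem hgen, isFrame_dualSystem hgen,
      reconstructs hgen hφ hg⟩⟩
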